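/- Let $J\ge 1$, $c>0$, $r_1,\dots,r_J>0$, and let $B_0$ be a finite, nonzero, continuous (atomless) Borel measure on a complete separable metric space $\Omega$; put $\gamma_0=B_0(\Omega)$ and $r_{\cdot}=\sum_j r_j$. Consider the group-size dependent mixed-membership model governed by the beta-negative binomial process (BNBP): $B=\sum_{k}p_k\delta_{\omega_k}\sim\mathrm{BP}(c,B_0)$ is a beta process, i.e. the points $(p_k,\omega_k)_{k\ge 1}$ form a Poisson point process on $(0,1)\times\Omega$ with intensity $\nu(dp\,d\omega)=p^{-1}(1-p)^{c-1}\,dp\,B_0(d\omega)$; given $B$, the weights $\theta_{jk}$ ($1\le j\le J$, $k\ge1$) are independent, $\theta_{jk}\sim\mathrm{Gamma}(r_j,\ \text{scale }p_k/(1-p_k))$; given $B$ and the $\theta_{jk}$, the group sizes $m_j\sim\mathrm{Pois}(\sum_k\theta_{jk})$ and the labels $z_{ji}$, with $P(z_{ji}=k)=\theta_{jk}/\sum_{l}\theta_{jl}$, are all independent. Group $j$ consists of the data points $(j,i)$, $1\le i\le m_j$, and the labels partition all data points into clusters of points with equal label. Let $\boldsymbol m=(m_1,\dots,m_J)\in\{0,1,2,\dots\}^J$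 be a fixed vector of group sizes with $m_{\cdot}=\sum_j m_j\ge 1$. For $K\ge1$ let $\sum_{\sum_{k=1}^{K}\boldsymbol n_{:k}=\boldsymbol m}$ denote summation over all ordered $K$-tuples of count vectors $\boldsymbol n_{:k}=(n_{1k},\dots,n_{Jk})\in\{0,1,2,\dots\}^J$ with $\sum_{k=1}^K\boldsymbol n_{:k}=\boldsymbol m$ and $n_{\cdot k}:=\sum_j n_{jk}\ge1$ for every $k$, and let $$D(\boldsymbol m)=\sum_{K'=1}^{m_{\cdot}}\frac{\gamma_0^{K'}}{K'!}\sum_{\sum_{k'=1}^{K'}\boldsymbol n_{:k'}=\boldsymbol m}\ \prod_{k'=1}^{K'}\left[\frac{\Gamma(n_{\cdot k'})\Gamma(c+r_{\cdot})}{\Gamma(c+n_{\cdot k'}+r_{\cdot})}\prod_{j=1}^J\frac{\Gamma(n_{jk'}+r_j)}{n_{jk'}!\,\Gamma(r_j)}\right].$$ Then, with $\psi=\Gamma'/\Gamma$: (i) the group sizes equal $\boldsymbol m$ with the positive probability $f(\boldsymbol m\mid\boldsymbol r,\gamma_0,c)=e^{-\gamma_0[\psi(c+r_{\cdot})-\psi(c)]}\,D(\boldsymbol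 m)$; (ii) given that the group sizes equal $\boldsymbol m$, the conditional probability that the partition into clusters is a given partition $\boldsymbol z$ of the $m_{\cdot}$ data points, with $K_J$ clusters of which the $k$-th has $n_{jk}$ points in group $j$, is $$f(\boldsymbol z\mid\boldsymbol m,\boldsymbol r,\gamma_0,c)=\frac{1}{D(\boldsymbol m)}\cdot\frac{\gamma_0^{K_J}}{\prod_{j=1}^Jm_j!}\prod_{k=1}^{K_J}\left[\frac{\Gamma(n_{\cdot k})\Gamma(c+r_{\cdot})}{\Gamma(c+n_{\cdot k}+r_{\cdot})}\prod_{j=1}^J\frac{\Gamma(n_{jk}+r_j)}{\Gamma(r_j)}\right];$$ (iii) this conditional probability depends only on the cluster sizes, regardless of their order: two partitions whose clusters have the same count vectors $(n_{1k},\dots,n_{Jk})$, counted with multiplicity and in any order, have the same conditional probability. -/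

import Mathlib

open MeasureTheory ProbabilityTheory

noncomputable section

namespace BNBP

/-- The Lévy measure `ν(dp dω) = p⁻¹ (1 - p) ^ (c - 1) dp B₀(dω)` of the beta process
`BP(c, B₀)`, carried by `(0, 1) × Ω`. -/
def betaLevy {Ω : Type*} [MeasurableSpace Ω] (c : ℝ) (B₀ : Measure Ω) : Measure (ℝ × Ω) :=
  ((volume.restrict (Set.Ioo (0 : ℝ) 1)).withDensity
    (fun p => ENNReal.ofReal (p⁻¹ * (1 - p) ^ (c - 1)))).prod B₀

/-- The random points `x 0, x 1, …` form a Poisson point process with intensity `ν`: the numbers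
of points in disjoint measurable sets of finite intensity are independent Poisson variables. -/
structure IsPoissonProcess {S E : Type*} [MeasurableSpace S] [MeasurableSpace E]
    (P : Measure S) (x : ℕ → S → E) (ν : Measure E) : Prop where
  measurable : ∀ k, Measurable (x k)
  counts : ∀ (N : ℕ) (A : Fin N → Set E), (∀ i, MeasurableSet (A i)) → (∀ i, ν (A i) ≠ ⊤) →
    Pairwise (fun i i' => Disjoint (A i) (A i')) → ∀ q : Fin N → ℕ,
      P {s | ∀ i, {k | x k s ∈ A i}.encard = (q i : ℕ∞)} =
        ∏ i, poissonMeasure (ν (A i)).toNNReal {q i}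

/-- Given `X`, the variables `Y i` are conditionally independent and `Y i` has the conditional
distribution `κ i X`. -/
def CondIndepWithLaw {S X' Y' ι : Type*} [MeasurableSpace S] [MeasurableSpace X']
    [MeasurableSpace Y'] (P : Measure S) (X : S → X') (Y : ι → S → Y')
    (κ : ι → X' → Measure Y') : Prop :=
  ∀ (F : Finset ι) (E : Set X') (A : ι → Set Y'), MeasurableSet E → (∀ i, MeasurableSet (A i)) →
    P {s | X s ∈ E ∧ ∀ i ∈ F, Y i s ∈ A i} = ∫⁻ s in X ⁻¹' E, ∏ i ∈ F, κ i (X s) (A i) ∂P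

/-- The distribution `∑ k, (t k / ∑ l, t l) δ_k` on the labels `k`. -/
def categorical (t : ℕ → ℝ) : Measure ℕ :=
  Measure.sum fun k => ENNReal.ofReal (t k / ∑' l, t l) • Measure.dirac k

/-- The group-size dependent mixed-membership model governed by the beta-negative binomial
process, with `J` groups, dispersion parameters `r`, concentration `c` and base measure `B₀`:
* `atom k = (p k, ω k)` are the atoms of the beta process `B = ∑ k, p k • δ_(ω k)`;
* `θ j k` are the weights of the gamma process `Θ j = ∑ k, θ j k • δ_(ω k)`; given `B` they are
  independent, gamma distributed with shape `r j` and scale `p k / (1 - p k)`, that is, rate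
  `(1 - p k) / p k`;
* given `B` and all `Θ j`, the group sizes `m j` and the labels `z j i` are independent, `m j` is
  Poisson with mean `Θ j (Ω) = ∑ k, θ j k`, and `z j i = k` with probability `θ j k / Θ j (Ω)`.
Group `j` consists of the data points `i < m j`. -/
structure IsModel {S Ω : Type*} [MeasurableSpace S] [MeasurableSpace Ω] {J : ℕ}
    (P : Measure S) (r : Fin J → ℝ) (c : ℝ) (B₀ : Measure Ω)
    (atom : ℕ → S → ℝ × Ω) (θ : Fin J → ℕ → S → ℝ) (m : Fin J → S → ℕ)
    (z : Fin J → ℕ → S → ℕ) : Prop where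
  beta_process : IsPoissonProcess P atom (betaLevy c B₀)
  measurable_weight : ∀ j k, Measurable (θ j k)
  measurable_size : ∀ j, Measurable (m j)
  measurable_label : ∀ j i, Measurable (z j i)
  gamma_process : CondIndepWithLaw P (fun s k => atom k s)
    (fun jk : Fin J × ℕ => θ jk.1 jk.2)
    (fun jk a => gammaMeasure (r jk.1) ((1 - (a jk.2).1) / (a jk.2).1))
  data : CondIndepWithLaw P (fun s => ((fun k => atom k s), (fun j k => θ j k s)))
    (Sum.elim m (fun ji : Fin J × ℕ => z ji.1 ji.2))
    (Sum.elim (fun j x => poissonMeasure (∑' k, x.2 j k).toNNReal)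
      (fun ji x => categorical (x.2 ji.1)))

/-- The data points `(j, i)`, `i < n j`, when the group sizes are `n`. -/
abbrev DataPoint {J : ℕ} (n : Fin J → ℕ) : Type := (j : Fin J) × Fin (n j)

open Classical in
/-- The partition of the data points into clusters of points with the same label. -/
def clusters {J : ℕ} (n : Fin J → ℕ) (label : DataPoint n → ℕ) :
    Finpartition (Finset.univ : Finset (DataPoint n)) :=
  Finpartition.ofSetoid (Setoid.ker label)

/-- The count vector `(n_{1k}, …, n_{Jk})` of a cluster: the number of its points in each group. -/
def clusterSize {J : ℕ} {n : Fin J → ℕ} (A : Finset (DataPoint n)) (j : Fin J) : ℕ :=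
  (A.filter fun x => x.1 = j).card

/-- `Γ(v.) Γ(c + r.) / Γ(c + v. + r.)`, where a dot denotes summation over the groups. -/
def columnTotalWeight {J : ℕ} (r : Fin J → ℝ) (c : ℝ) (v : Fin J → ℕ) : ℝ :=
  Real.Gamma (∑ j, (v j : ℝ)) * Real.Gamma (c + ∑ j, r j) /
    Real.Gamma (c + ∑ j, (v j : ℝ) + ∑ j, r j)

/-- The numerator of the exchangeable partition probability function. -/
def eppfNumerator {J : ℕ} (r : Fin J → ℝ) (c γ₀ : ℝ) (n : Fin J → ℕ)
    (π : Finpartition (Finset.univ : Finset (DataPoint n))) : ℝ :=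
  γ₀ ^ π.parts.card / (∏ j, ((n j).factorial : ℝ)) *
    ∏ A ∈ π.parts, (columnTotalWeight r c (clusterSize A) *
      ∏ j, Real.Gamma (clusterSize A j + r j) / Real.Gamma (r j))

/-- The ordered decompositions of the count vector `n` into `K` nonzero count vectors. -/
def decompositions {J : ℕ} (n : Fin J → ℕ) (K : ℕ) : Finset (Fin K → Fin J → ℕ) :=
  (Fintype.piFinset fun _ : Fin K => Finset.Iic n).filter
    fun v => (∑ k, v k = n) ∧ ∀ k, 1 ≤ ∑ j, v k j

/-- The denominator of the exchangeable partition probability function. -/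
def eppfDenominator {J : ℕ} (r : Fin J → ℝ) (c γ₀ : ℝ) (n : Fin J → ℕ) : ℝ :=
  ∑ K ∈ Finset.Icc 1 (∑ j, n j), γ₀ ^ K / (K.factorial : ℝ) *
    ∑ v ∈ decompositions n K, ∏ k, (columnTotalWeight r c (v k) *
      ∏ j, Real.Gamma (v k j + r j) / ((v k j).factorial * Real.Gamma (r j)))

/-- The digamma function on the reals. -/
def digamma (x : ℝ) : ℝ := logDeriv Real.Gamma x

end BNBP

end

noncomputable section

namespace BNBP

open scoped ENNReal NNReal Topology
open Filter

/-! ### Counting injections with prescribed values -/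

/-! The key quantity is the joint probability that the group sizes are `n` and the partition is `π`.
Labels index atoms, so this event is the disjoint union, over injections `e` from the blocks of `π`
to ℕ, of the events that each block `A` carries the label `e A`. Given the weights, the total mass
to the power `n j` in the Poisson probability cancels the normalisations of the `n j` categorical
labels in group `j`. What is left is `1 / (n j)!` times the exponential of minus the total mass
times a monomial in the weights (`poisson_mul_categorical`, `IsModel.measure_labels`).

Integrating out the gamma weights given the atoms (`IsModel.lintegral_weights`) turns each weight's
contribution into a Gamma ratio times `p ^ count * (1 - p) ^ r j`. The sum over `e` is then a sum
over tuples of distinct points of a Poisson process, multiplied by a product over all its points.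
The Campbell–Mecke formula `IsPoissonProcess.lintegral_tsum_embedding` evaluates its expectation:
each block contributes `γ₀` times a beta integral, and the product over all points contributes an
exponential whose exponent is a difference of digamma values
(`lintegral_one_sub_rpow_eq_digamma_sub`). The result, `IsModel.measure_clusters`, is a constant
times `eppfNumerator`.

The law of the group sizes comes from summing over all partitions. `sum_eppfNumerator` identifies
the sum of the numerators with `eppfDenominator` by counting surjective labellings with `K` labels
in two ways: `K!` for each partition into `K` blocks, and a product of multinomial coefficients for
each ordered decomposition of `n`. The exponential constant cancels in the conditional probability,
and the numerator depends only on the multiset of cluster count vectors. -/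

/-- Injections sending the fibre of `c` over `t` into `S t`, for disjoint sets `S t`. -/
def embeddingPiEquiv {I T L : Type*} (c : I → T) (S : T → Set L)
    (hS : Pairwise fun t t' => Disjoint (S t) (S t')) :
    {e : I ↪ L // ∀ i, e i ∈ S (c i)} ≃ ∀ t, ({i // c i = t} ↪ S t) where
  toFun e t := ⟨fun i => ⟨e.1 i.1, by obtain ⟨i, rfl⟩ := i; exact e.2 i⟩, fun i i' h =>
    Subtype.ext (e.1.injective (congrArg Subtype.val h))⟩
  invFun h := ⟨⟨fun i => (h (c i) ⟨i, rfl⟩ : L), by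
      intro i i' hii
      have key : ∀ t (h1 : c i = t) (h2 : c i' = t),
          (h t ⟨i, h1⟩ : L) = h t ⟨i', h2⟩ → i = i' := fun t h1 h2 hh =>
        congrArg Subtype.val ((h t).injective (Subtype.ext hh))
      have hc : c i = c i' := by
        by_contra hne
        refine Set.disjoint_left.1 (hS hne) (h (c i) ⟨i, rfl⟩).2 ?_
        have := (h (c i') ⟨i', rfl⟩).2
        rwa [← show (h (c i) ⟨i, rfl⟩ : L) = h (c i') ⟨i', rfl⟩ from hii] at this
      refine key (c i') hc rfl ?_
      have aux : ∀ t (ht : c i = t), (h t ⟨i, ht⟩ : L) = h (c i) ⟨i, rfl⟩ := by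
        rintro _ rfl; rfl
      rw [aux _ hc]
      exact hii⟩, fun i => (h (c i) ⟨i, rfl⟩).2⟩
  left_inv e := by ext i; rfl
  right_inv h := by
    funext t
    ext ⟨i, rfl⟩
    rfl

/-- The summand is 1 or 0, so the sum counts the injections that respect the prescribed cells.
Because the cells are disjoint, such an injection is an independent choice of injections cell by
cell, which gives falling factorials of the point counts. -/
lemma tsum_embedding_indicator {I T E : Type*} [Fintype I] [Fintype T] [DecidableEq T] (c : I → T)
    (x : ℕ → E) (A : T → Set E) (hA : Pairwise fun t t' => Disjoint (A t) (A t'))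
    (hfin : ∀ t, {k | x k ∈ A t}.Finite) :
    ∑' e : I ↪ ℕ, ∏ i, (A (c i)).indicator (fun _ => (1 : ℝ≥0∞)) (x (e i)) =
      ∏ t, (({k | x k ∈ A t}.ncard.descFactorial (Fintype.card {i // c i = t}) : ℕ) : ℝ≥0∞) := by
  classical
  have h1 : ∀ e : I ↪ ℕ, ∏ i, (A (c i)).indicator (fun _ => (1 : ℝ≥0∞)) (x (e i)) =
      {e : I ↪ ℕ | ∀ i, e i ∈ {k | x k ∈ A (c i)}}.indicator (fun _ => 1) e := by
    intro e
    by_cases h : ∀ i, x (e i) ∈ A (c i)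
    · rw [Set.indicator_of_mem (by exact h)]
      exact Finset.prod_eq_one fun i _ => Set.indicator_of_mem (h i) _
    · rw [Set.indicator_of_notMem (by exact h)]
      push Not at h
      obtain ⟨i, hi⟩ := h
      exact Finset.prod_eq_zero (Finset.mem_univ i) (Set.indicator_of_notMem hi _)
  simp_rw [h1]
  rw [← tsum_subtype, ENNReal.tsum_one]
  have hS : Pairwise fun t t' => Disjoint {k | x k ∈ A t} {k | x k ∈ A t'} := fun t t' h =>
    Set.disjoint_left.2 fun k hk hk' => Set.disjoint_left.1 (hA h) hk hk'
  have e := embeddingPiEquiv c (fun t => {k | x k ∈ A t}) hS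
  have : ∀ t, Fintype {k | x k ∈ A t} := fun t => (hfin t).fintype
  have h2 : ENat.card {e : I ↪ ℕ // ∀ i, e i ∈ {k | x k ∈ A (c i)}} =
      ((∏ t, {k | x k ∈ A t}.ncard.descFactorial (Fintype.card {i // c i = t}) : ℕ) : ℕ∞) := by
    rw [ENat.card_congr e, ENat.card_eq_coe_fintype_card, Fintype.card_pi]
    congr 1
    refine Finset.prod_congr rfl fun t _ => ?_
    rw [Fintype.card_embedding_eq, Set.ncard_eq_toFinset_card', Set.toFinset_card]
  change ((ENat.card {e : I ↪ ℕ // ∀ i, e i ∈ {k | x k ∈ A (c i)}} : ℕ∞) : ℝ≥0∞) = _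
  rw [h2, ENat.toENNReal_coe, Nat.cast_prod]

/-! ### Poisson counts -/

lemma lintegral_poissonMeasure (l : ℝ≥0) (f : ℕ → ℝ≥0∞) :
    ∫⁻ q, f q ∂poissonMeasure l =
      ∑' q : ℕ, ENNReal.ofReal (Real.exp (-l) * l ^ q / q.factorial) * f q := by
  rw [poissonMeasure, lintegral_sum_measure]
  simp_rw [lintegral_smul_measure, lintegral_dirac, smul_eq_mul]

lemma lintegral_poissonMeasure_descFactorial_mul_pow (l g : ℝ≥0) (d : ℕ) :
    ∫⁻ q, (q.descFactorial d : ℝ≥0∞) * (g : ℝ≥0∞) ^ q ∂poissonMeasure l =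
      ((l : ℝ≥0∞) * g) ^ d * ENNReal.ofReal (Real.exp (-(l * (1 - g)))) := by
  rw [lintegral_poissonMeasure, ← Summable.sum_add_tsum_nat_add' (k := d) ENNReal.summable,
    Finset.sum_eq_zero, zero_add]
  · have h1 : ∀ q : ℕ, ENNReal.ofReal (Real.exp (-l) * l ^ (q + d) / (q + d).factorial) *
        (((q + d).descFactorial d : ℝ≥0∞) * (g : ℝ≥0∞) ^ (q + d)) =
        ((l : ℝ≥0∞) * g) ^ d * ENNReal.ofReal (Real.exp (-(l * (1 - g)))) *
          ENNReal.ofReal (Real.exp (-(l * g : ℝ≥0)) * (l * g : ℝ≥0) ^ q / q.factorial) := by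
      intro q
      rw [← ENNReal.ofReal_coe_nnreal (p := g), ← ENNReal.ofReal_coe_nnreal (p := l),
        ← ENNReal.ofReal_natCast, ← ENNReal.ofReal_pow (by positivity),
        ← ENNReal.ofReal_mul (by positivity), ← ENNReal.ofReal_mul (by positivity),
        ← ENNReal.ofReal_mul (by positivity), ← ENNReal.ofReal_pow (by positivity),
        ← ENNReal.ofReal_mul (by positivity), ← ENNReal.ofReal_mul (by positivity)]
      congr 1
      have h2 : Real.exp (-l) = Real.exp (-(l * (1 - g))) * Real.exp (-(l * g : ℝ≥0)) := by
        rw [← Real.exp_add]; congr 1; push_cast; ring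
      have h3 : ((q + d).factorial : ℝ) = q.factorial * (q + d).descFactorial d := by
        have := Nat.factorial_mul_descFactorial (Nat.le_add_left d q)
        rw [Nat.add_sub_cancel] at this
        exact_mod_cast this.symm
      have h4 : ((q + d).descFactorial d : ℝ) ≠ 0 := by
        have := Nat.factorial_ne_zero (q + d)
        rw [← @Nat.cast_ne_zero ℝ, h3] at this
        exact right_ne_zero_of_mul this
      rw [h3, h2]
      push_cast
      field_simp
      ring
    simp_rw [h1]
    rw [ENNReal.tsum_mul_left]
    -- After the shift by `d`, the terms are the Poisson mass function of mean `l * g`, with total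
    -- mass 1.
    have h2 := lintegral_poissonMeasure (l * g) (fun _ => 1)
    simp only [mul_one, lintegral_const, measure_univ] at h2
    rw [← h2, mul_one]
  · intro q hq
    rw [Nat.descFactorial_eq_zero_iff_lt.2 (Finset.mem_range.1 hq)]
    simp

section Poisson

variable {S E : Type*} [MeasurableSpace S] [MeasurableSpace E] {P : Measure S}
  {x : ℕ → S → E} {ν : Measure E}

lemma measurable_encard (hx : ∀ k, Measurable (x k)) {A : Set E} (hA : MeasurableSet A) :
    Measurable fun s => {k | x k s ∈ A}.encard := by
  have h1 : ∀ s, (({k | x k s ∈ A}.encard : ℕ∞) : ℝ≥0∞) =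
      ∑' k, A.indicator (fun _ => 1) (x k s) := by
    intro s
    rw [← ENNReal.tsum_set_one, tsum_subtype {k | x k s ∈ A} (fun _ => (1 : ℝ≥0∞))]
    rfl
  have h2 : Measurable fun s => (({k | x k s ∈ A}.encard : ℕ∞) : ℝ≥0∞) := by
    simp_rw [h1]
    exact Measurable.tsum fun k => (measurable_const.indicator hA).comp (hx k)
  refine measurable_to_countable' fun q => ?_
  have : (fun s => {k | x k s ∈ A}.encard) ⁻¹' {q} =
      (fun s => (({k | x k s ∈ A}.encard : ℕ∞) : ℝ≥0∞)) ⁻¹' {(q : ℝ≥0∞)} := by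
    ext s; simp
  rw [this]
  exact h2 (measurableSet_singleton _)

lemma IsPoissonProcess.measure_encard_eq (h : IsPoissonProcess P x ν) {T : Type*} [Fintype T]
    (A : T → Set E) (hA : ∀ t, MeasurableSet (A t)) (hν : ∀ t, ν (A t) ≠ ⊤)
    (hd : Pairwise fun t t' => Disjoint (A t) (A t')) (q : T → ℕ) :
    P {s | ∀ t, {k | x k s ∈ A t}.encard = (q t : ℕ∞)} =
      ∏ t, poissonMeasure (ν (A t)).toNNReal {q t} := by
  let e := Fintype.equivFin T
  have := h.counts (Fintype.card T) (fun i => A (e.symm i)) (fun i => hA _) (fun i => hν _)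
    (fun i i' hi => hd (e.symm.injective.ne hi)) (fun i => q (e.symm i))
  rw [Equiv.prod_comp e.symm (fun t => poissonMeasure (ν (A t)).toNNReal {q t})] at this
  rw [← this]
  congr 1
  ext s
  simp only [Set.mem_ofPred_eq]
  exact ⟨fun h i => h _, fun h t => by simpa using h (e t)⟩

/-- The probabilities of the finite counts are Poisson masses and already sum to 1, so an infinite
count has probability 0. -/
lemma IsPoissonProcess.ae_finite [IsProbabilityMeasure P] (h : IsPoissonProcess P x ν) {A : Set E}
    (hA : MeasurableSet A) (hν : ν A ≠ ⊤) : ∀ᵐ s ∂P, {k | x k s ∈ A}.Finite := by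
  have h1 : ∀ q : ℕ, P {s | {k | x k s ∈ A}.encard = (q : ℕ∞)} =
      poissonMeasure (ν A).toNNReal {q} := fun q => by
    simpa using h.measure_encard_eq (T := Unit) (fun _ => A) (fun _ => hA) (fun _ => hν)
      (fun a b hab => (hab rfl).elim) (fun _ => q)
  have hm := measurable_encard h.measurable hA
  have h2 : P (⋃ q : ℕ, {s | {k | x k s ∈ A}.encard = (q : ℕ∞)}) = 1 := by
    rw [measure_iUnion]
    · simp_rw [h1]
      rw [← measure_univ (μ := poissonMeasure (ν A).toNNReal),
        ← Set.iUnion_of_singleton ℕ, measure_iUnion]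
      · intro a b hab; simpa using hab
      · intro q; exact MeasurableSet.of_discrete
    · intro a b hab
      refine Set.disjoint_left.2 fun s hs hs' => hab ?_
      simp only [Set.mem_ofPred_eq] at hs hs'
      exact_mod_cast hs.symm.trans hs'
    · intro q
      exact hm (measurableSet_singleton _)
  have h3 : ∀ᵐ s ∂P, s ∈ ⋃ q : ℕ, {s | {k | x k s ∈ A}.encard = (q : ℕ∞)} := by
    have hmeas : MeasurableSet (⋃ q : ℕ, {s | {k | x k s ∈ A}.encard = (q : ℕ∞)}) :=
      MeasurableSet.iUnion fun q => hm (measurableSet_singleton _)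
    rw [← prob_compl_eq_zero_iff hmeas] at h2
    exact h2
  filter_upwards [h3] with s hs
  obtain ⟨q, hq⟩ := Set.mem_iUnion.1 hs
  exact Set.finite_of_encard_eq_coe hq

lemma IsPoissonProcess.lintegral_prod_ncard [IsProbabilityMeasure P] (h : IsPoissonProcess P x ν)
    {T : Type*} [Fintype T]
    (A : T → Set E) (hA : ∀ t, MeasurableSet (A t)) (hν : ∀ t, ν (A t) ≠ ⊤)
    (hd : Pairwise fun t t' => Disjoint (A t) (A t')) (f : T → ℕ → ℝ≥0∞) :
    ∫⁻ s, ∏ t, f t {k | x k s ∈ A t}.ncard ∂P =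
      ∏ t, ∫⁻ q, f t q ∂poissonMeasure (ν (A t)).toNNReal := by
  have hm : Measurable fun s => fun t => {k | x k s ∈ A t}.ncard := by
    refine measurable_pi_iff.2 fun t => ?_
    exact (measurable_from_top (f := ENat.toNat)).comp (measurable_encard h.measurable (hA t))
  -- `ncard` is 0 on infinite sets, so it can replace `encard` only where the counts are finite.
  have hae : ∀ᵐ s ∂P, ∀ t, {k | x k s ∈ A t}.Finite :=
    ae_all_iff.2 fun t => h.ae_finite (hA t) (hν t)
  have hlaw : P.map (fun s => fun t => {k | x k s ∈ A t}.ncard) =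
      Measure.pi fun t => poissonMeasure (ν (A t)).toNNReal := by
    refine Measure.ext_of_singleton fun q => ?_
    rw [Measure.map_apply hm (measurableSet_singleton _), Measure.pi_singleton,
      ← h.measure_encard_eq A hA hν hd]
    refine measure_congr ?_
    filter_upwards [hae] with s hs
    refine propext ?_
    change (fun t => {k | x k s ∈ A t}.ncard) = q ↔ ∀ t, {k | x k s ∈ A t}.encard = (q t : ℕ∞)
    rw [funext_iff]
    refine forall_congr' fun t => ?_
    rw [← (hs t).cast_ncard_eq]
    norm_cast
  have hf : Measurable fun q : T → ℕ => ∏ t, f t (q t) := Measurable.of_discrete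
  rw [← lintegral_map (f := fun q : T → ℕ => ∏ t, f t (q t)) hf hm, hlaw]
  have hind := iIndepFun_pi (μ := fun t => poissonMeasure (ν (A t)).toNNReal)
    (X := f) fun t => Measurable.of_discrete.aemeasurable
  rw [lintegral_prod_eq_prod_lintegral_of_indepFun Finset.univ _ hind
    fun t => Measurable.of_discrete]
  refine Finset.prod_congr rfl fun t _ => ?_
  exact (measurePreserving_eval (fun t => poissonMeasure (ν (A t)).toNNReal) t).lintegral_comp
    Measurable.of_discrete

end Poisson

/-! ### Limits of sums and products of extended nonnegative reals -/

lemma tendsto_tsum_of_monotone {α : Type*} {f : ℕ → α → ℝ≥0∞} {F : α → ℝ≥0∞}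
    (hmono : ∀ a, Monotone fun n => f n a) (hf : ∀ a, Tendsto (fun n => f n a) atTop (𝓝 (F a))) :
    Tendsto (fun n => ∑' a, f n a) atTop (𝓝 (∑' a, F a)) := by
  have hF : ∀ a, F a = ⨆ n, f n a := fun a =>
    tendsto_nhds_unique (hf a) (tendsto_atTop_iSup (hmono a))
  have h1 : ∑' a, F a = ⨆ n, ∑' a, f n a := by
    simp_rw [hF, ENNReal.tsum_eq_iSup_sum]
    rw [iSup_comm]
    exact iSup_congr fun s => ENNReal.finsetSum_iSup_of_monotone hmono
  rw [h1]
  exact tendsto_atTop_iSup fun n n' h => ENNReal.tsum_le_tsum fun a => hmono a h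

/-- With factors at most 1, an infinite product is the infimum of its finite subproducts, and infima
commute. -/
lemma tendsto_tprod_of_antitone {α : Type*} {f : ℕ → α → ℝ≥0∞} {F : α → ℝ≥0∞}
    (hanti : ∀ a, Antitone fun n => f n a) (h1 : ∀ n a, f n a ≤ 1)
    (hf : ∀ a, Tendsto (fun n => f n a) atTop (𝓝 (F a))) :
    Tendsto (fun n => ∏' a, f n a) atTop (𝓝 (∏' a, F a)) := by
  have hF1 : ∀ a, F a ≤ 1 := fun a => le_of_tendsto' (hf a) fun n => h1 n a
  have hanti' : ∀ s : Finset α, Antitone fun n => ∏ a ∈ s, f n a := fun s n n' h =>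
    Finset.prod_le_prod' fun a _ => hanti a h
  have hprod : ∀ s : Finset α, ∏ a ∈ s, F a = ⨅ n, ∏ a ∈ s, f n a := fun s => by
    refine tendsto_nhds_unique (ENNReal.tendsto_finsetProd_of_ne_top s (fun a _ => hf a)
      fun a _ => ((hF1 a).trans_lt ENNReal.one_lt_top).ne) (tendsto_atTop_iInf (hanti' s))
  have h2 : ∏' a, F a = ⨅ n, ∏' a, f n a := by
    rw [ENNReal.tprod_eq_iInf_prod hF1]
    simp_rw [ENNReal.tprod_eq_iInf_prod (h1 _), hprod]
    exact iInf_comm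
  rw [h2]
  refine tendsto_atTop_iInf fun n n' h => ?_
  simp only [ENNReal.tprod_eq_iInf_prod (h1 _)]
  exact iInf_mono fun s => hanti' s h

lemma tprod_le_one {α : Type*} {f : α → ℝ≥0∞} (h : ∀ a, f a ≤ 1) : ∏' a, f a ≤ 1 := by
  rw [ENNReal.tprod_eq_iInf_prod h]
  exact iInf_le_of_le ∅ (by simp)

/-! ### The Campbell–Mecke formula for Poisson processes -/

section Campbell

variable {S E : Type*} [MeasurableSpace S] [MeasurableSpace E] {P : Measure S}
  {x : ℕ → S → E} {ν : Measure E} {I : Type*} [Fintype I]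

lemma measurable_tprod {f : ℕ → S → ℝ≥0∞} (hf : ∀ k, Measurable (f k)) (h1 : ∀ k s, f k s ≤ 1) :
    Measurable fun s => ∏' k, f k s := by
  simp_rw [fun s => ENNReal.tprod_eq_iInf_prod (fun k => h1 k s)]
  exact Measurable.iInf fun F => Finset.measurable_fun_prod _ fun k _ => hf k

lemma measurable_ncard (hx : ∀ k, Measurable (x k)) {A : Set E} (hA : MeasurableSet A) :
    Measurable fun s => {k | x k s ∈ A}.ncard :=
  (measurable_from_top (f := ENat.toNat)).comp (measurable_encard hx hA)

lemma measurable_tsum_embedding {f : I → E → ℝ≥0∞} (hx : ∀ k, Measurable (x k))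
    (hf : ∀ i, Measurable (f i)) :
    Measurable fun s => ∑' e : I ↪ ℕ, ∏ i, f i (x (e i) s) := by
  have : Countable (I ↪ ℕ) := Function.Embedding.coe_injective.countable
  exact Measurable.tsum fun e => Finset.measurable_fun_prod _ fun i _ => (hf i).comp (hx _)

/-- This is the formula for functions constant on finitely many cells. Expanding the product over
`i` assigns a cell to each index. For each assignment the sum over injections is a product of
falling factorials of independent Poisson counts, whose weighted moments are explicit. -/
lemma IsPoissonProcess.lintegral_tsum_embedding_cells [IsProbabilityMeasure P]
    (h : IsPoissonProcess P x ν) {T : Type*} [Fintype T]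
    (A : T → Set E) (hA : ∀ t, MeasurableSet (A t)) (hν : ∀ t, ν (A t) ≠ ⊤)
    (hd : Pairwise fun t t' => Disjoint (A t) (A t')) (a : I → T → ℝ≥0∞) (g : T → ℝ≥0) :
    ∫⁻ s, (∑' e : I ↪ ℕ, ∏ i, ∑ t, a i t * (A t).indicator (fun _ => 1) (x (e i) s)) *
        ∏ t, (g t : ℝ≥0∞) ^ {k | x k s ∈ A t}.ncard ∂P =
      (∏ i, ∑ t, a i t * (ν (A t) * g t)) *
        ENNReal.ofReal (Real.exp (-∑ t, (ν (A t)).toReal * (1 - g t))) := by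
  classical
  have hae : ∀ᵐ s ∂P, ∀ t, {k | x k s ∈ A t}.Finite :=
    ae_all_iff.2 fun t => h.ae_finite (hA t) (hν t)
  let D : (I → T) → T → ℕ → ℝ≥0∞ := fun c t q =>
    (q.descFactorial (Fintype.card {i // c i = t}) : ℝ≥0∞) * (g t : ℝ≥0∞) ^ q
  have hDm : ∀ c, Measurable fun s => ∏ t, D c t {k | x k s ∈ A t}.ncard := fun c =>
    Finset.measurable_fun_prod _ fun t _ =>
      (Measurable.of_discrete (f := D c t)).comp (measurable_ncard h.measurable (hA t))
  have h1 : ∀ᵐ s ∂P, (∑' e : I ↪ ℕ, ∏ i, ∑ t, a i t * (A t).indicator (fun _ => 1) (x (e i) s)) *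
        ∏ t, (g t : ℝ≥0∞) ^ {k | x k s ∈ A t}.ncard =
      ∑ c : I → T, (∏ i, a i (c i)) * ∏ t, D c t {k | x k s ∈ A t}.ncard := by
    filter_upwards [hae] with s hs
    simp_rw [Fintype.prod_sum]
    rw [Summable.tsum_finsetSum fun _ _ => ENNReal.summable, Finset.sum_mul]
    refine Finset.sum_congr rfl fun c _ => ?_
    simp_rw [Finset.prod_mul_distrib (f := fun i => a i (c i))]
    rw [ENNReal.tsum_mul_left, tsum_embedding_indicator c (fun k => x k s) A hd hs, mul_assoc,
      ← Finset.prod_mul_distrib]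
  rw [lintegral_congr_ae h1, lintegral_finsetSum]
  · have h2 : ∀ c : I → T, ∫⁻ s, (∏ i, a i (c i)) * ∏ t, D c t {k | x k s ∈ A t}.ncard ∂P =
        (∏ i, a i (c i) * (ν (A (c i)) * g (c i))) *
          ENNReal.ofReal (Real.exp (-∑ t, (ν (A t)).toReal * (1 - g t))) := by
      intro c
      rw [lintegral_const_mul _ (hDm c), h.lintegral_prod_ncard A hA hν hd]
      simp_rw [D, lintegral_poissonMeasure_descFactorial_mul_pow, ENNReal.coe_toNNReal (hν _)]
      rw [← Finset.sum_neg_distrib, Real.exp_sum, ENNReal.ofReal_prod_of_nonneg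
        fun _ _ => (Real.exp_pos _).le, Finset.prod_mul_distrib, Finset.prod_mul_distrib,
        ← mul_assoc]
      congr 2
      rw [← Finset.prod_fiberwise (s := Finset.univ) c (fun i => ν (A (c i)) * (g (c i) : ℝ≥0∞))]
      refine Finset.prod_congr rfl fun t _ => ?_
      rw [Finset.prod_congr rfl (g := fun _ => ν (A t) * (g t : ℝ≥0∞))
        (fun i hi => by rw [(Finset.mem_filter.1 hi).2]), Finset.prod_const,
        Fintype.card_subtype]
    simp_rw [h2]
    rw [← Finset.sum_mul, Fintype.prod_sum]
  · exact fun c _ => (hDm c).const_mul _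

/-- The joint level sets of all the `f i` and of `φ` serve as cells. -/
lemma IsPoissonProcess.lintegral_tsum_embedding_simpleFunc [IsProbabilityMeasure P]
    (h : IsPoissonProcess P x ν) (f : I → SimpleFunc E ℝ≥0∞) (φ : SimpleFunc E ℝ≥0∞)
    (hf : ∀ i, (f i).FinMeasSupp ν) (hφ : φ.FinMeasSupp ν) (hφ1 : ∀ y, φ y ≤ 1) :
    ∫⁻ s, (∑' e : I ↪ ℕ, ∏ i, f i (x (e i) s)) * ∏' k, (1 - φ (x k s)) ∂P =
      (∏ i, ∫⁻ y, f i y * (1 - φ y) ∂ν) * ENNReal.ofReal (Real.exp (-(∫⁻ y, φ y ∂ν).toReal)) := by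
  classical
  let F : Option I → SimpleFunc E ℝ≥0∞ := fun o => o.elim φ f
  have hF : ∀ o, (F o).FinMeasSupp ν := by rintro (_ | i); exacts [hφ, hf i]
  let Φ : E → Option I → ℝ≥0∞ := fun y o => F o y
  have hΦm : ∀ v, MeasurableSet (Φ ⁻¹' {v}) := fun v => by
    have : Φ ⁻¹' {v} = ⋂ o, F o ⁻¹' {v o} := by
      ext y; simp [Φ, funext_iff]
    rw [this]
    exact MeasurableSet.iInter fun o => (F o).measurableSet_preimage _
  have hΦfin : (Set.range Φ).Finite := by
    refine (Set.Finite.pi' (t := fun o => ((F o).range : Set ℝ≥0∞))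
      fun o => Finset.finite_toSet _).subset ?_
    rintro _ ⟨y, rfl⟩ o
    exact (F o).mem_range_self y
  -- The cell on which every function vanishes is dropped: it may have infinite measure, and it
  -- contributes nothing.
  let R : Finset (Option I → ℝ≥0∞) := hΦfin.toFinset.filter (· ≠ 0)
  have hR : ∀ y, Φ y ≠ 0 → Φ y ∈ R := fun y hy => by simp [R, hy]
  let A : R → Set E := fun v => Φ ⁻¹' {v.1}
  have hA : ∀ v, MeasurableSet (A v) := fun v => hΦm _
  have hν : ∀ v, ν (A v) ≠ ⊤ := fun v => by
    have hv : v.1 ≠ 0 := (Finset.mem_filter.1 v.2).2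
    obtain ⟨o, ho⟩ := Function.ne_iff.1 hv
    refine ne_top_of_le_ne_top ((hF o).meas_preimage_singleton_ne_zero ho).ne (measure_mono ?_)
    intro y hy
    exact congrFun hy o
  have hd : Pairwise fun v v' => Disjoint (A v) (A v') := fun v v' hne =>
    Set.disjoint_left.2 fun y hy hy' => hne (Subtype.ext (Eq.trans (Eq.symm hy) hy'))
  have hsum : ∀ ψ : (Option I → ℝ≥0∞) → ℝ≥0∞, ψ 0 = 0 → ∀ y,
      ψ (Φ y) = ∑ v : R, ψ v * (A v).indicator (fun _ => 1) y := by
    intro ψ hψ y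
    by_cases hy : Φ y = 0
    · rw [hy, hψ, Finset.sum_eq_zero]
      intro v _
      rw [Set.indicator_of_notMem, mul_zero]
      intro hv
      exact (Finset.mem_filter.1 v.2).2 (Eq.trans (Eq.symm hv) hy)
    · rw [Finset.sum_eq_single ⟨Φ y, hR y hy⟩]
      · rw [Set.indicator_of_mem (by rfl), mul_one]
      · intro v _ hv
        rw [Set.indicator_of_notMem, mul_zero]
        intro hv'
        exact hv (Subtype.ext (Eq.symm hv'))
      · simp
  have hint : ∀ ψ : (Option I → ℝ≥0∞) → ℝ≥0∞, ψ 0 = 0 →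
      ∫⁻ y, ψ (Φ y) ∂ν = ∑ v : R, ψ v * ν (A v) := by
    intro ψ hψ
    simp_rw [hsum ψ hψ]
    rw [lintegral_finsetSum _ fun v _ => (measurable_const.indicator (hA v)).const_mul _]
    refine Finset.sum_congr rfl fun v _ => ?_
    rw [lintegral_const_mul _ (measurable_const.indicator (hA v)), lintegral_indicator_const (hA v),
      one_mul]
  let g : R → ℝ≥0 := fun v => (1 - v.1 none).toNNReal
  have hg : ∀ v, (g v : ℝ≥0∞) = 1 - v.1 none := fun v =>
    ENNReal.coe_toNNReal (ne_top_of_le_ne_top ENNReal.one_ne_top tsub_le_self)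
  have hv1 : ∀ v : R, v.1 none ≤ 1 := fun v => by
    have hv := (Finset.mem_filter.1 v.2).1
    obtain ⟨y, hy⟩ := hΦfin.mem_toFinset.1 hv
    rw [← hy]
    exact hφ1 y
  have key := h.lintegral_tsum_embedding_cells A hA hν hd (fun i v => v.1 (some i)) g
  have hae : ∀ᵐ s ∂P, ∀ v, {k | x k s ∈ A v}.Finite :=
    ae_all_iff.2 fun v => h.ae_finite (hA v) (hν v)
  have hL : ∀ᵐ s ∂P, (∑' e : I ↪ ℕ, ∏ i, f i (x (e i) s)) * ∏' k, (1 - φ (x k s)) =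
      (∑' e : I ↪ ℕ, ∏ i, ∑ v : R, v.1 (some i) * (A v).indicator (fun _ => 1) (x (e i) s)) *
        ∏ v, (g v : ℝ≥0∞) ^ {k | x k s ∈ A v}.ncard := by
    filter_upwards [hae] with s hs
    congr 1
    · refine tsum_congr fun e => Finset.prod_congr rfl fun i _ => ?_
      exact hsum (fun v => v (some i)) rfl (x (e i) s)
    -- Only the finitely many points in the cells give factors different from 1.
    · let U : Finset ℕ := Finset.univ.biUnion fun v => (hs v).toFinset
      rw [tprod_eq_prod (s := U)]
      · rw [Finset.prod_biUnion]
        · refine Finset.prod_congr rfl fun v _ => ?_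
          rw [Finset.prod_congr rfl (g := fun _ => (g v : ℝ≥0∞)), Finset.prod_const,
            Set.ncard_eq_toFinset_card _ (hs v)]
          intro k hk
          have : Φ (x k s) = v.1 := (hs v).mem_toFinset.1 hk
          rw [hg, ← this]
          rfl
        · intro v _ v' _ hne
          refine Finset.disjoint_left.2 fun k hk hk' => ?_
          exact Set.disjoint_left.1 (hd hne) ((hs v).mem_toFinset.1 hk)
            ((hs v').mem_toFinset.1 hk')
      · intro k hk
        have h0 : Φ (x k s) = 0 := by
          by_contra hne
          refine hk (Finset.mem_biUnion.2 ⟨⟨_, hR _ hne⟩, Finset.mem_univ _, ?_⟩)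
          exact (hs _).mem_toFinset.2 rfl
        have : φ (x k s) = 0 := congrFun h0 none
        rw [this, tsub_zero]
  rw [lintegral_congr_ae hL, key]
  congr 1
  · refine Finset.prod_congr rfl fun i _ => ?_
    refine Eq.trans ?_ (hint (fun v => v (some i) * (1 - v none)) (by simp)).symm
    refine Finset.sum_congr rfl fun v _ => ?_
    rw [hg]
    ring
  · rw [show ∫⁻ y, φ y ∂ν = _ from hint (fun v => v none) rfl,
      ENNReal.toReal_sum fun v _ => ENNReal.mul_ne_top
        (ne_top_of_le_ne_top ENNReal.one_ne_top (hv1 v)) (hν v)]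
    congr 3
    refine Finset.sum_congr rfl fun v _ => ?_
    have : (g v : ℝ) = 1 - (v.1 none).toReal := by
      rw [← ENNReal.coe_toReal, hg, ENNReal.toReal_sub_of_le (hv1 v) ENNReal.one_ne_top,
        ENNReal.toReal_one]
    rw [this, ENNReal.toReal_mul]
    ring

lemma finMeasSupp_eapprox {f : E → ℝ≥0∞} (hf : Measurable f) (hint : ∫⁻ y, f y ∂ν ≠ ⊤) (M : ℕ) :
    (SimpleFunc.eapprox f M).FinMeasSupp ν := by
  refine SimpleFunc.FinMeasSupp.of_lintegral_ne_top ?_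
  rw [← SimpleFunc.lintegral_eq_lintegral]
  refine ne_top_of_le_ne_top hint (lintegral_mono fun y => ?_)
  rw [← SimpleFunc.iSup_eapprox_apply hf y]
  exact le_iSup (fun n => SimpleFunc.eapprox f n y) M

/-- Both sides increase with `f`, so monotone convergence extends `f` while `φ` stays simple.
Passing to general `φ` is a separate step because the left side decreases in `φ`. -/
lemma IsPoissonProcess.lintegral_tsum_embedding_simpleFunc_right [IsProbabilityMeasure P]
    (h : IsPoissonProcess P x ν) (f : I → E → ℝ≥0∞) (φ : SimpleFunc E ℝ≥0∞)
    (hf : ∀ i, Measurable (f i)) (hft : ∀ i y, f i y ≠ ⊤) (hfi : ∀ i, ∫⁻ y, f i y ∂ν ≠ ⊤)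
    (hφ : φ.FinMeasSupp ν) (hφ1 : ∀ y, φ y ≤ 1) :
    ∫⁻ s, (∑' e : I ↪ ℕ, ∏ i, f i (x (e i) s)) * ∏' k, (1 - φ (x k s)) ∂P =
      (∏ i, ∫⁻ y, f i y * (1 - φ y) ∂ν) * ENNReal.ofReal (Real.exp (-(∫⁻ y, φ y ∂ν).toReal)) := by
  have hmono : ∀ i y, Monotone fun M => SimpleFunc.eapprox (f i) M y := fun i y M M' hM =>
    SimpleFunc.monotone_eapprox (f i) hM y
  have hpm : ∀ s (e : I ↪ ℕ), Monotone fun M => ∏ i, SimpleFunc.eapprox (f i) M (x (e i) s) :=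
    fun s e M M' hM => Finset.prod_le_prod' fun i _ => hmono i _ hM
  have hgm : Measurable fun s => ∏' k, (1 - φ (x k s)) :=
    measurable_tprod (fun k => (φ.measurable.comp (h.measurable k)).const_sub 1)
      fun k s => tsub_le_self
  have key : ∀ M, _ := fun M => h.lintegral_tsum_embedding_simpleFunc
    (fun i => SimpleFunc.eapprox (f i) M) φ (fun i => finMeasSupp_eapprox (hf i) (hfi i) M) hφ hφ1
  have hL : Tendsto (fun M => ∫⁻ s, (∑' e : I ↪ ℕ, ∏ i, SimpleFunc.eapprox (f i) M (x (e i) s)) *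
      ∏' k, (1 - φ (x k s)) ∂P) atTop
      (𝓝 (∫⁻ s, (∑' e : I ↪ ℕ, ∏ i, f i (x (e i) s)) * ∏' k, (1 - φ (x k s)) ∂P)) := by
    refine lintegral_tendsto_of_tendsto_of_monotone (fun M => ?_) (ae_of_all _ fun s => ?_)
      (ae_of_all _ fun s => ?_)
    · exact ((measurable_tsum_embedding h.measurable
        fun i => (SimpleFunc.eapprox (f i) M).measurable).mul hgm).aemeasurable
    · exact fun M M' hM => mul_le_mul_left (ENNReal.tsum_le_tsum fun e => hpm s e hM) _
    · refine ENNReal.Tendsto.mul_const (tendsto_tsum_of_monotone (hpm s) fun e => ?_) (Or.inr ?_)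
      · exact ENNReal.tendsto_finsetProd_of_ne_top _
          (fun i _ => SimpleFunc.tendsto_eapprox (hf i) _) fun i _ => hft i _
      · exact ne_top_of_le_ne_top ENNReal.one_ne_top (tprod_le_one fun k => tsub_le_self)
  have hR : Tendsto (fun M => (∏ i, ∫⁻ y, SimpleFunc.eapprox (f i) M y * (1 - φ y) ∂ν) *
      ENNReal.ofReal (Real.exp (-(∫⁻ y, φ y ∂ν).toReal))) atTop
      (𝓝 ((∏ i, ∫⁻ y, f i y * (1 - φ y) ∂ν) *
        ENNReal.ofReal (Real.exp (-(∫⁻ y, φ y ∂ν).toReal)))) := by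
    refine ENNReal.Tendsto.mul_const ?_ (Or.inr ENNReal.ofReal_ne_top)
    refine ENNReal.tendsto_finsetProd_of_ne_top _ (fun i _ => ?_) fun i _ => ?_
    · refine lintegral_tendsto_of_tendsto_of_monotone (fun M => ?_) (ae_of_all _ fun y => ?_)
        (ae_of_all _ fun y => ?_)
      · exact ((SimpleFunc.eapprox (f i) M).measurable.mul
          (φ.measurable.const_sub 1)).aemeasurable
      · exact fun M M' hM => mul_le_mul_left (hmono i y hM) _
      · exact ENNReal.Tendsto.mul_const (SimpleFunc.tendsto_eapprox (hf i) _)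
          (Or.inr (ne_top_of_le_ne_top ENNReal.one_ne_top tsub_le_self))
    · refine ne_top_of_le_ne_top (hfi i) (lintegral_mono fun y => ?_)
      exact mul_le_of_le_one_right' tsub_le_self
  exact tendsto_nhds_unique (hL.congr key) hR

/-- The Campbell–Mecke formula for a Poisson process: the expectation of the sum of
`∏ i, f i (x (e i))` over the tuples of distinct points, multiplied by the product of `1 - φ` over
all points. -/
theorem IsPoissonProcess.lintegral_tsum_embedding [IsProbabilityMeasure P]
    (h : IsPoissonProcess P x ν) (f : I → E → ℝ≥0∞) (φ : E → ℝ≥0∞)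
    (hf : ∀ i, Measurable (f i)) (hft : ∀ i y, f i y ≠ ⊤) (hfi : ∀ i, ∫⁻ y, f i y ∂ν ≠ ⊤)
    (hφ : Measurable φ) (hφ1 : ∀ y, φ y ≤ 1) (hφi : ∫⁻ y, φ y ∂ν ≠ ⊤) :
    ∫⁻ s, (∑' e : I ↪ ℕ, ∏ i, f i (x (e i) s)) * ∏' k, (1 - φ (x k s)) ∂P =
      (∏ i, ∫⁻ y, f i y * (1 - φ y) ∂ν) * ENNReal.ofReal (Real.exp (-(∫⁻ y, φ y ∂ν).toReal)) := by
  let ψ : ℕ → SimpleFunc E ℝ≥0∞ := SimpleFunc.eapprox φ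
  have hψφ : ∀ M y, ψ M y ≤ φ y := fun M y => by
    rw [← SimpleFunc.iSup_eapprox_apply hφ y]
    exact le_iSup (fun n => SimpleFunc.eapprox φ n y) M
  have hψm : ∀ y, Monotone fun M => ψ M y := fun y M M' hM => SimpleFunc.monotone_eapprox φ hM y
  have hψ1 : ∀ M y, ψ M y ≤ 1 := fun M y => (hψφ M y).trans (hφ1 y)
  have hψt : ∀ y, Tendsto (fun M => ψ M y) atTop (𝓝 (φ y)) := SimpleFunc.tendsto_eapprox hφ
  have hsubt : ∀ y, Tendsto (fun M => 1 - ψ M y) atTop (𝓝 (1 - φ y)) := fun y =>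
    ENNReal.Tendsto.sub tendsto_const_nhds (hψt y) (Or.inl ENNReal.one_ne_top)
  have key : ∀ M, _ := fun M => h.lintegral_tsum_embedding_simpleFunc_right f (ψ M) hf hft hfi
    (finMeasSupp_eapprox hφ hφi M) (hψ1 M)
  -- The case `φ = 0` supplies the integrable bound for dominated convergence as the approximations
  -- of `φ` increase.
  have hfin : ∫⁻ s, (∑' e : I ↪ ℕ, ∏ i, f i (x (e i) s)) ∂P ≠ ⊤ := by
    have h0 := h.lintegral_tsum_embedding_simpleFunc_right f 0 hf hft hfi
      (by simp [SimpleFunc.FinMeasSupp]) (by simp)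
    simp only [SimpleFunc.coe_zero, Pi.zero_apply, tsub_zero, tprod_one, mul_one] at h0
    rw [h0]
    exact ENNReal.mul_ne_top (ENNReal.prod_ne_top fun i _ => hfi i) ENNReal.ofReal_ne_top
  have hm := measurable_tsum_embedding (x := x) h.measurable hf
  have hL : Tendsto (fun M => ∫⁻ s, (∑' e : I ↪ ℕ, ∏ i, f i (x (e i) s)) *
      ∏' k, (1 - ψ M (x k s)) ∂P) atTop
      (𝓝 (∫⁻ s, (∑' e : I ↪ ℕ, ∏ i, f i (x (e i) s)) * ∏' k, (1 - φ (x k s)) ∂P)) := by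
    refine tendsto_lintegral_of_dominated_convergence _ (fun M => ?_)
      (fun M => ae_of_all _ fun s => ?_) hfin ?_
    · exact hm.mul (measurable_tprod
        (fun k => ((ψ M).measurable.comp (h.measurable k)).const_sub 1) fun k s => tsub_le_self)
    · exact mul_le_of_le_one_right' (tprod_le_one fun k => tsub_le_self)
    · filter_upwards [ae_lt_top hm hfin] with s hs
      refine ENNReal.Tendsto.const_mul ?_ (Or.inr hs.ne)
      exact tendsto_tprod_of_antitone (fun k M M' hM => tsub_le_tsub_left (hψm _ hM) 1)
        (fun M k => tsub_le_self) fun k => hsubt _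
  have hR : Tendsto (fun M => (∏ i, ∫⁻ y, f i y * (1 - ψ M y) ∂ν) *
      ENNReal.ofReal (Real.exp (-(∫⁻ y, ψ M y ∂ν).toReal))) atTop
      (𝓝 ((∏ i, ∫⁻ y, f i y * (1 - φ y) ∂ν) *
        ENNReal.ofReal (Real.exp (-(∫⁻ y, φ y ∂ν).toReal)))) := by
    have hle : ∀ i, ∫⁻ y, f i y * (1 - φ y) ∂ν ≠ ⊤ := fun i =>
      ne_top_of_le_ne_top (hfi i) (lintegral_mono fun y => mul_le_of_le_one_right' tsub_le_self)
    refine ENNReal.Tendsto.mul ?_ (Or.inr ENNReal.ofReal_ne_top) ?_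
      (Or.inr (ENNReal.prod_ne_top fun i _ => hle i))
    · refine ENNReal.tendsto_finsetProd_of_ne_top _ (fun i _ => ?_) fun i _ => hle i
      refine tendsto_lintegral_of_dominated_convergence (f i)
        (fun M => (hf i).mul ((ψ M).measurable.const_sub 1))
        (fun M => ae_of_all _ fun y => mul_le_of_le_one_right' tsub_le_self) (hfi i)
        (ae_of_all _ fun y => ?_)
      exact ENNReal.Tendsto.const_mul (hsubt y) (Or.inr (hft i y))
    · refine ENNReal.tendsto_ofReal ((Real.continuous_exp.tendsto _).comp (Tendsto.neg ?_))
      refine (ENNReal.tendsto_toReal hφi).comp ?_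
      exact lintegral_tendsto_of_tendsto_of_monotone (fun M => (ψ M).measurable.aemeasurable)
        (ae_of_all _ hψm) (ae_of_all _ hψt)
  exact tendsto_nhds_unique (hL.congr key) hR

end Campbell

/-! ### Conditionally independent variables -/

/-- The defining property is the case of indicators. The indicators are replaced by general
functions one index at a time, by linearity and monotone convergence. -/
lemma CondIndepWithLaw.lintegral_prod {S X' Y' ι : Type*} [MeasurableSpace S] [MeasurableSpace X']
    [MeasurableSpace Y'] {P : Measure S} {X : S → X'} {Y : ι → S → Y'} {κ : ι → X' → Measure Y'}
    (h : CondIndepWithLaw P X Y κ) (hX : Measurable X) (hY : ∀ i, Measurable (Y i))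
    (hκ : ∀ i, Measurable (κ i)) (F : Finset ι) {E : Set X'} (hE : MeasurableSet E)
    {u : ι → Y' → ℝ≥0∞} (hu : ∀ i, Measurable (u i)) :
    ∫⁻ s in X ⁻¹' E, ∏ i ∈ F, u i (Y i s) ∂P =
      ∫⁻ s in X ⁻¹' E, ∏ i ∈ F, ∫⁻ y, u i y ∂κ i (X s) ∂P := by
  classical
  have hκu : ∀ i (w : Y' → ℝ≥0∞), Measurable w → Measurable fun s => ∫⁻ y, w y ∂κ i (X s) :=
    fun i w hw => (Measure.measurable_lintegral hw).comp ((hκ i).comp hX)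
  -- `G` collects the indices at which `u` is already arbitrary; elsewhere it is still an indicator.
  suffices H : ∀ G : Finset ι, ∀ u : ι → Y' → ℝ≥0∞, (∀ i, Measurable (u i)) →
      (∀ i ∉ G, ∃ A, MeasurableSet A ∧ u i = A.indicator fun _ => 1) →
      ∫⁻ s in X ⁻¹' E, ∏ i ∈ F, u i (Y i s) ∂P =
        ∫⁻ s in X ⁻¹' E, ∏ i ∈ F, ∫⁻ y, u i y ∂κ i (X s) ∂P by
    have hF := H F (fun i => if i ∈ F then u i else Set.univ.indicator fun _ => 1)
      (fun i => by
        by_cases hi : i ∈ F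
        · simpa [hi] using hu i
        · simp [hi])
      (fun i hi => ⟨Set.univ, MeasurableSet.univ, by simp [hi]⟩)
    have e1 : ∀ s, ∏ i ∈ F, (if i ∈ F then u i else Set.univ.indicator fun _ => 1) (Y i s) =
        ∏ i ∈ F, u i (Y i s) := fun s => Finset.prod_congr rfl fun i hi => by rw [if_pos hi]
    have e2 : ∀ s, ∏ i ∈ F,
        ∫⁻ y, (if i ∈ F then u i else Set.univ.indicator fun _ => 1) y ∂κ i (X s) =
        ∏ i ∈ F, ∫⁻ y, u i y ∂κ i (X s) :=
      fun s => Finset.prod_congr rfl fun i hi => by rw [if_pos hi]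
    simp_rw [e1, e2] at hF
    exact hF
  intro G
  induction G using Finset.induction_on with
  | empty =>
    intro u _ hA
    choose A hA hAu using fun i => hA i (Finset.notMem_empty i)
    simp_rw [hAu, lintegral_indicator_const (hA _), one_mul]
    rw [← h F E A hE hA]
    have hset : MeasurableSet {s | ∀ i ∈ F, Y i s ∈ A i} := by
      have : {s | ∀ i ∈ F, Y i s ∈ A i} = ⋂ i ∈ F, Y i ⁻¹' A i := by ext s; simp
      rw [this]
      exact Finset.measurableSet_biInter _ fun i _ => hY i (hA i)
    have e1 : ∀ s, ∏ i ∈ F, (A i).indicator (fun _ => (1 : ℝ≥0∞)) (Y i s) =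
        {s | ∀ i ∈ F, Y i s ∈ A i}.indicator (fun _ => 1) s := by
      intro s
      by_cases hs : ∀ i ∈ F, Y i s ∈ A i
      · rw [Set.indicator_of_mem (by exact hs)]
        exact Finset.prod_eq_one fun i hi => Set.indicator_of_mem (hs i hi) _
      · rw [Set.indicator_of_notMem (by exact hs)]
        push Not at hs
        obtain ⟨i, hi, hi'⟩ := hs
        exact Finset.prod_eq_zero hi (Set.indicator_of_notMem hi' _)
    simp_rw [e1]
    rw [lintegral_indicator_const hset, one_mul, Measure.restrict_apply hset]
    congr 1
    ext s
    simp [and_comm]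
  | insert i G hi ih =>
    intro u hu hA
    by_cases hiF : i ∈ F
    · have hR : Measurable fun s => ∏ j ∈ F.erase i, u j (Y j s) :=
        Finset.measurable_fun_prod _ fun j _ => (hu j).comp (hY j)
      have hR' : Measurable fun s => ∏ j ∈ F.erase i, ∫⁻ y, u j y ∂κ j (X s) :=
        Finset.measurable_fun_prod _ fun j _ => hκu j _ (hu j)
      have hM : ∀ w : Y' → ℝ≥0∞, Measurable w →
          Measurable fun s => w (Y i s) * ∏ j ∈ F.erase i, u j (Y j s) :=
        fun w hw => (hw.comp (hY i)).mul hR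
      have hM' : ∀ w : Y' → ℝ≥0∞, Measurable w → Measurable fun s =>
          (∫⁻ y, w y ∂κ i (X s)) * ∏ j ∈ F.erase i, ∫⁻ y, u j y ∂κ j (X s) :=
        fun w hw => (hκu i w hw).mul hR'
      have key : ∀ w : Y' → ℝ≥0∞, Measurable w →
          ∫⁻ s in X ⁻¹' E, w (Y i s) * ∏ j ∈ F.erase i, u j (Y j s) ∂P =
          ∫⁻ s in X ⁻¹' E, (∫⁻ y, w y ∂κ i (X s)) *
            ∏ j ∈ F.erase i, ∫⁻ y, u j y ∂κ j (X s) ∂P := by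
        intro w hw
        refine Measurable.ennreal_induction (fun c A hAm => ?_) (fun f g _ hf hg ihf ihg => ?_)
          (fun f hf hmono ih => ?_) hw
        · have hi1 : Measurable (A.indicator fun _ => (1 : ℝ≥0∞)) := measurable_const.indicator hAm
          have := ih (Function.update u i (A.indicator fun _ => 1))
            (fun j => by
              by_cases hj : j = i
              · subst hj; simpa using hi1
              · simpa [hj] using hu j)
            (fun j hj => by
              by_cases hji : j = i
              · subst hji; exact ⟨A, hAm, by simp⟩
              · simpa [hji] using hA j (by simp [hji, hj]))
          have e1 : ∀ s, ∏ j ∈ F, Function.update u i (A.indicator fun _ => 1) j (Y j s) =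
              A.indicator (fun _ => 1) (Y i s) * ∏ j ∈ F.erase i, u j (Y j s) := fun s => by
            rw [← Finset.mul_prod_erase F _ hiF, Function.update_self]
            congr 1
            exact Finset.prod_congr rfl fun j hj => by
              rw [Function.update_of_ne (Finset.ne_of_mem_erase hj)]
          have e2 : ∀ s, ∏ j ∈ F,
              ∫⁻ y, Function.update u i (A.indicator fun _ => 1) j y ∂κ j (X s) =
              (∫⁻ y, A.indicator (fun _ => 1) y ∂κ i (X s)) *
                ∏ j ∈ F.erase i, ∫⁻ y, u j y ∂κ j (X s) := fun s => by
            rw [← Finset.mul_prod_erase F _ hiF, Function.update_self]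
            congr 1
            exact Finset.prod_congr rfl fun j hj => by
              rw [Function.update_of_ne (Finset.ne_of_mem_erase hj)]
          simp_rw [e1, e2] at this
          have e3 : ∀ y, A.indicator (fun _ => c) y = c * A.indicator (fun _ => 1) y := fun y => by
            by_cases hy : y ∈ A <;> simp [hy]
          simp_rw [e3, lintegral_const_mul _ hi1, mul_assoc]
          rw [lintegral_const_mul _ (hM _ hi1), this,
            lintegral_const_mul _ (hM' _ hi1)]
        · simp_rw [Pi.add_apply, lintegral_add_left hf, add_mul]
          rw [lintegral_add_left (hM _ hf), ihf, ihg,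
            lintegral_add_left (hM' _ hf)]
        · simp_rw [lintegral_iSup hf hmono, ENNReal.iSup_mul]
          rw [lintegral_iSup (fun n => hM _ (hf n))
            (fun n n' hn s => mul_le_mul_left (hmono hn _) _),
            lintegral_iSup (fun n => hM' _ (hf n))
            (fun n n' hn s => mul_le_mul_left (lintegral_mono (hmono hn)) _)]
          exact iSup_congr ih
      have := key (u i) (hu i)
      have e1 : ∀ s, u i (Y i s) * ∏ j ∈ F.erase i, u j (Y j s) = ∏ j ∈ F, u j (Y j s) :=
        fun s => Finset.mul_prod_erase F (fun j => u j (Y j s)) hiF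
      have e2 : ∀ s, (∫⁻ y, u i y ∂κ i (X s)) * ∏ j ∈ F.erase i, ∫⁻ y, u j y ∂κ j (X s) =
          ∏ j ∈ F, ∫⁻ y, u j y ∂κ j (X s) :=
        fun s => Finset.mul_prod_erase F (fun j => ∫⁻ y, u j y ∂κ j (X s)) hiF
      simp_rw [e1, e2] at this
      exact this
    · have := ih (Function.update u i (Set.univ.indicator fun _ => 1))
        (fun j => by
          by_cases hj : j = i
          · subst hj; simp
          · simpa [hj] using hu j)
        (fun j hj => by
          by_cases hji : j = i
          · subst hji; exact ⟨Set.univ, MeasurableSet.univ, by simp⟩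
          · simpa [hji] using hA j (by simp [hji, hj]))
      have e0 : ∀ j ∈ F, Function.update u i (Set.univ.indicator fun _ => 1) j = u j :=
        fun j hj => Function.update_of_ne (fun hji : j = i => hiF (hji ▸ hj)) _ _
      have e1 : ∀ s, ∏ j ∈ F, Function.update u i (Set.univ.indicator fun _ => 1) j (Y j s) =
          ∏ j ∈ F, u j (Y j s) := fun s => Finset.prod_congr rfl fun j hj => by rw [e0 j hj]
      have e2 : ∀ s, ∏ j ∈ F,
          ∫⁻ y, Function.update u i (Set.univ.indicator fun _ => 1) j y ∂κ j (X s) =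
          ∏ j ∈ F, ∫⁻ y, u j y ∂κ j (X s) :=
        fun s => Finset.prod_congr rfl fun j hj => by rw [e0 j hj]
      simp_rw [e1, e2] at this
      exact this

/-! ### Gamma distributions -/

lemma measurable_gammaMeasure (a : ℝ) : Measurable fun b : ℝ => gammaMeasure a b := by
  refine Measure.measurable_of_measurable_coe _ fun A hA => ?_
  simp_rw [gammaMeasure, withDensity_apply _ hA]
  refine Measurable.lintegral_prod_right' (f := fun q : ℝ × ℝ => gammaPDF a q.1 q.2) ?_
  refine ENNReal.measurable_ofReal.comp ?_
  exact Measurable.ite (measurableSet_le measurable_const measurable_snd) (by fun_prop)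
    measurable_const

/-- Multiplying the gamma density by `t ^ n * exp (-q t)` gives a constant multiple of the gamma
density with shape `a + n` and rate `b + q`. -/
lemma lintegral_gammaMeasure_pow_mul_exp {a b q : ℝ} (ha : 0 < a) (hb : 0 < b) (hq : 0 ≤ q)
    (n : ℕ) :
    ∫⁻ t, ENNReal.ofReal (t ^ n * Real.exp (-(q * t))) ∂gammaMeasure a b =
      ENNReal.ofReal (Real.Gamma (n + a) / Real.Gamma a * (b ^ a / (b + q) ^ (a + n))) := by
  have hbq : 0 < b + q := by linarith
  have han : 0 < a + n := by positivity
  have hG1 := Real.Gamma_pos_of_pos ha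
  have hG2 := Real.Gamma_pos_of_pos han
  have hm : Measurable fun t : ℝ => ENNReal.ofReal (t ^ n * Real.exp (-(q * t))) := by fun_prop
  have hpm : Measurable (gammaPDF a b) := (measurable_gammaPDFReal a b).ennreal_ofReal
  have hpm' : Measurable (gammaPDF (a + n) (b + q)) :=
    (measurable_gammaPDFReal _ _).ennreal_ofReal
  rw [gammaMeasure, lintegral_withDensity_eq_lintegral_mul _ hpm hm]
  set C : ℝ := Real.Gamma (n + a) / Real.Gamma a * (b ^ a / (b + q) ^ (a + n)) with hC
  have hC0 : 0 ≤ C := by rw [hC, add_comm (n : ℝ)]; positivity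
  have h1 : ∀ᵐ t : ℝ, (gammaPDF a b * fun t => ENNReal.ofReal (t ^ n * Real.exp (-(q * t)))) t =
      ENNReal.ofReal C * gammaPDF (a + n) (b + q) t := by
    -- The splitting of the power of `t` used below needs `t > 0`; the origin is a null set.
    have h0 : ∀ᵐ t : ℝ, t ≠ 0 := by simp [ae_iff]
    filter_upwards [h0] with t ht
    rw [Pi.mul_apply]
    rcases lt_or_gt_of_ne ht with ht | ht
    · rw [gammaPDF_of_neg ht, gammaPDF_of_neg ht, zero_mul, mul_zero]
    · rw [gammaPDF_of_nonneg ht.le, gammaPDF_of_nonneg ht.le, ← ENNReal.ofReal_mul (by positivity),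
        ← ENNReal.ofReal_mul hC0]
      congr 1
      have e1 : t ^ (a + n - 1) = t ^ (a - 1) * t ^ n := by
        rw [← Real.rpow_natCast t n, ← Real.rpow_add ht]; congr 1; ring
      have e2 : Real.exp (-((b + q) * t)) = Real.exp (-(b * t)) * Real.exp (-(q * t)) := by
        rw [← Real.exp_add]; congr 1; ring
      rw [e1, e2, hC, add_comm (n : ℝ)]
      have : (b + q) ^ (a + n) ≠ 0 := (Real.rpow_pos_of_pos hbq _).ne'
      field_simp
  rw [lintegral_congr_ae h1, lintegral_const_mul _ hpm', lintegral_gammaPDF_eq_one han hbq, mul_one]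

/-- The rate `(1 - p) / p` increased by 1 is `p⁻¹`, which makes the integral a product of powers of
`p` and `1 - p`. -/
lemma lintegral_gammaMeasure_pow_mul_exp_neg {a p : ℝ} (ha : 0 < a) (hp : p ∈ Set.Ioo (0 : ℝ) 1)
    (n : ℕ) :
    ∫⁻ t, ENNReal.ofReal (t ^ n * Real.exp (-t)) ∂gammaMeasure a ((1 - p) / p) =
      ENNReal.ofReal (Real.Gamma (n + a) / Real.Gamma a * ((1 - p) ^ a * p ^ n)) := by
  have hp0 := hp.1
  have hp1 : 0 < 1 - p := sub_pos.2 hp.2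
  have := lintegral_gammaMeasure_pow_mul_exp ha (div_pos hp1 hp0) zero_le_one n
  simp only [one_mul] at this
  rw [this]
  congr 2
  have e : (1 - p) / p + 1 = p⁻¹ := by field_simp; ring
  rw [e, Real.div_rpow hp1.le hp0.le, Real.inv_rpow hp0.le, Real.rpow_add hp0, Real.rpow_natCast]
  have : p ^ a ≠ 0 := (Real.rpow_pos_of_pos hp0 _).ne'
  field_simp

lemma lintegral_gammaMeasure_id {a b : ℝ} (ha : 0 < a) (hb : 0 < b) :
    ∫⁻ t, ENNReal.ofReal t ∂gammaMeasure a b = ENNReal.ofReal (a / b) := by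
  have := lintegral_gammaMeasure_pow_mul_exp ha hb le_rfl 1
  simp only [pow_one, zero_mul, neg_zero, Real.exp_zero, mul_one, Nat.cast_one, add_zero] at this
  rw [this, add_comm 1 a, Real.Gamma_add_one ha.ne', Real.rpow_add hb, Real.rpow_one]
  have := (Real.rpow_pos_of_pos hb a).ne'
  have := (Real.Gamma_pos_of_pos ha).ne'
  congr 1
  field_simp

lemma gammaMeasure_Iio_zero (a b : ℝ) : gammaMeasure a b (Set.Iio 0) = 0 := by
  rw [gammaMeasure, withDensity_apply _ measurableSet_Iio, lintegral_gammaPDF_of_nonpos le_rfl]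

/-! ### Beta integrals and the digamma function -/

lemma lintegral_Ioo_beta {α β : ℝ} (hα : 0 < α) (hβ : 0 < β) :
    ∫⁻ p in Set.Ioo (0 : ℝ) 1, ENNReal.ofReal (p ^ (α - 1) * (1 - p) ^ (β - 1)) =
      ENNReal.ofReal (beta α β) := by
  have hb := beta_pos hα hβ
  have h1 := lintegral_betaPDF_eq_one hα hβ
  rw [lintegral_betaPDF] at h1
  simp_rw [mul_assoc, ENNReal.ofReal_mul (one_div_pos.2 hb).le] at h1
  rw [lintegral_const_mul _ (by fun_prop)] at h1
  have h2 : ENNReal.ofReal (beta α β) * ENNReal.ofReal (1 / beta α β) = 1 := by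
    rw [← ENNReal.ofReal_mul hb.le, mul_one_div_cancel hb.ne', ENNReal.ofReal_one]
  calc _ = ENNReal.ofReal (beta α β) * ENNReal.ofReal (1 / beta α β) *
        ∫⁻ p in Set.Ioo (0 : ℝ) 1, ENNReal.ofReal (p ^ (α - 1) * (1 - p) ^ (β - 1)) := by
        rw [h2, one_mul]
    _ = _ := by rw [mul_assoc, h1, mul_one]

/-- Since `Γ(ε) = Γ(ε + 1) / ε`, the difference equals `Γ(ε + 1)` times the difference quotient at 0
of `Γ(c) / Γ(ε + c) - Γ(d) / Γ(ε + d)`. Both fractions equal 1 at `ε = 0` and have derivatives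
`-ψ(c)` and `-ψ(d)` there. -/
lemma tendsto_beta_sub_beta {c d : ℝ} (hc : 0 < c) (hd : 0 < d) :
    Tendsto (fun ε => beta ε c - beta ε d) (𝓝[>] 0) (𝓝 (digamma d - digamma c)) := by
  have hG : ∀ x : ℝ, 0 < x → HasDerivAt Real.Gamma (deriv Real.Gamma x) x := fun x hx =>
    (Real.differentiableAt_Gamma fun m => by
      have : (0 : ℝ) ≤ m := m.cast_nonneg
      linarith).hasDerivAt
  have hder : ∀ x : ℝ, 0 < x →
      HasDerivAt (fun ε => Real.Gamma x / Real.Gamma (ε + x)) (-digamma x) 0 := by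
    intro x hx
    have h0 := (Real.Gamma_pos_of_pos hx).ne'
    have h1 : HasDerivAt (fun ε => Real.Gamma (ε + x)) (deriv Real.Gamma x) 0 := by
      have := hG x hx
      rw [← zero_add x] at this
      simpa using this.comp_add_const 0 x
    have h2 := (hasDerivAt_const (0 : ℝ) (Real.Gamma x)).div h1 (by simpa using h0)
    refine h2.congr_deriv ?_
    simp only [zero_add, zero_mul, zero_sub, digamma, logDeriv_apply]
    field_simp
  have hk := (hder c hc).sub (hder d hd)
  have hslope := (hasDerivAt_iff_tendsto_slope_zero.1 hk).mono_left
    (nhdsWithin_mono (0 : ℝ) (fun y (hy : (0 : ℝ) < y) => hy.ne'))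
  have hone : Tendsto (fun ε : ℝ => Real.Gamma (ε + 1)) (𝓝[>] 0) (𝓝 1) := by
    have h1 : ContinuousAt (fun ε : ℝ => Real.Gamma (ε + 1)) 0 := by
      refine ContinuousAt.comp (g := Real.Gamma) ?_ (by fun_prop)
      simpa using (hG 1 one_pos).continuousAt
    have := h1.tendsto
    simp only [zero_add, Real.Gamma_one] at this
    exact this.mono_left nhdsWithin_le_nhds
  have := hone.mul hslope
  rw [one_mul, neg_sub_neg] at this
  refine this.congr' ?_
  filter_upwards [self_mem_nhdsWithin] with ε hε
  have hε : (0 : ℝ) < ε := hε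
  simp only [Pi.sub_apply, zero_add, smul_eq_mul, beta]
  rw [Real.Gamma_add_one hε.ne', div_self (Real.Gamma_pos_of_pos hc).ne',
    div_self (Real.Gamma_pos_of_pos hd).ne']
  field_simp
  ring

/-- Splitting the integrand directly would give two divergent integrals at `p = 0`. With `p ^ (ε -
1)` in place of `p⁻¹` each is a beta integral, and monotone convergence as `ε` decreases to 0
recovers the original. The sign statement is what later makes `ENNReal.ofReal` lossless. -/
lemma lintegral_one_sub_rpow_eq_digamma_sub {c r : ℝ} (hc : 0 < c) (hr : 0 ≤ r) :
    0 ≤ digamma (c + r) - digamma c ∧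
    ∫⁻ p in Set.Ioo (0 : ℝ) 1,
      ENNReal.ofReal (p⁻¹ * (1 - p) ^ (c - 1) * (1 - (1 - p) ^ r)) =
      ENNReal.ofReal (digamma (c + r) - digamma c) := by
  let ε : ℕ → ℝ := fun n => 1 / ((n : ℝ) + 1)
  have hε : ∀ n, 0 < ε n := fun n => by positivity
  have hεanti : Antitone ε := fun n n' h => one_div_le_one_div_of_le (by positivity) (by
    have : (n : ℝ) ≤ n' := by exact_mod_cast h
    linarith)
  have hεt : Tendsto ε atTop (𝓝[>] 0) :=
    tendsto_nhdsWithin_iff.2 ⟨tendsto_one_div_add_atTop_nhds_zero_nat, Eventually.of_forall hε⟩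
  have hcr : 0 < c + r := by linarith
  have hlim := (tendsto_beta_sub_beta hc hcr).comp hεt
  have hint : ∀ n, ∫⁻ p in Set.Ioo (0 : ℝ) 1,
      ENNReal.ofReal (p ^ (ε n - 1) * (1 - p) ^ (c - 1) * (1 - (1 - p) ^ r)) =
      ENNReal.ofReal (beta (ε n) c) - ENNReal.ofReal (beta (ε n) (c + r)) := by
    intro n
    rw [← lintegral_Ioo_beta (hε n) hc, ← lintegral_Ioo_beta (hε n) hcr, ← lintegral_sub]
    · refine setLIntegral_congr_fun measurableSet_Ioo fun p hp => ?_
      have hp0 := hp.1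
      have hp1 : 0 < 1 - p := sub_pos.2 hp.2
      rw [← ENNReal.ofReal_sub _ (by positivity)]
      congr 1
      rw [show c + r - 1 = (c - 1) + r by ring, Real.rpow_add hp1]
      ring
    · fun_prop
    · rw [lintegral_Ioo_beta (hε n) hcr]
      exact ENNReal.ofReal_ne_top
    · refine (ae_restrict_iff' measurableSet_Ioo).2 (ae_of_all _ fun p hp => ?_)
      have hp0 := hp.1
      have hp1 : 0 < 1 - p := sub_pos.2 hp.2
      refine ENNReal.ofReal_le_ofReal (mul_le_mul_of_nonneg_left ?_ (by positivity))
      exact Real.rpow_le_rpow_of_exponent_ge hp1 (by linarith) (by linarith)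
  have hle : ∀ n, beta (ε n) (c + r) ≤ beta (ε n) c := by
    intro n
    rw [← ENNReal.ofReal_le_ofReal_iff (beta_pos (hε n) hc).le, ← lintegral_Ioo_beta (hε n) hc,
      ← lintegral_Ioo_beta (hε n) hcr]
    refine setLIntegral_mono (by fun_prop) fun p hp => ?_
    have hp0 := hp.1
    have hp1 : 0 < 1 - p := sub_pos.2 hp.2
    refine ENNReal.ofReal_le_ofReal (mul_le_mul_of_nonneg_left ?_ (by positivity))
    exact Real.rpow_le_rpow_of_exponent_ge hp1 (by linarith) (by linarith)
  refine ⟨ge_of_tendsto' hlim fun n => sub_nonneg.2 (hle n), ?_⟩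
  refine tendsto_nhds_unique ?_ (ENNReal.tendsto_ofReal hlim)
  have hconv : Tendsto (fun n => ∫⁻ p in Set.Ioo (0 : ℝ) 1,
      ENNReal.ofReal (p ^ (ε n - 1) * (1 - p) ^ (c - 1) * (1 - (1 - p) ^ r))) atTop
      (𝓝 (∫⁻ p in Set.Ioo (0 : ℝ) 1,
        ENNReal.ofReal (p⁻¹ * (1 - p) ^ (c - 1) * (1 - (1 - p) ^ r)))) := by
    refine lintegral_tendsto_of_tendsto_of_monotone (fun n => by fun_prop) ?_ ?_
    · refine (ae_restrict_iff' measurableSet_Ioo).2 (ae_of_all _ fun p hp n n' hn => ?_)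
      have hp0 := hp.1
      have hp1 : 0 < 1 - p := sub_pos.2 hp.2
      refine ENNReal.ofReal_le_ofReal ?_
      have h1 : (1 - p) ^ r ≤ 1 := Real.rpow_le_one hp1.le (by linarith) hr
      refine mul_le_mul_of_nonneg_right (mul_le_mul_of_nonneg_right ?_ (by positivity))
        (by linarith)
      exact Real.rpow_le_rpow_of_exponent_ge hp0 hp.2.le (by linarith [hεanti hn])
    · refine (ae_restrict_iff' measurableSet_Ioo).2 (ae_of_all _ fun p hp => ?_)
      have hp0 := hp.1
      refine ENNReal.tendsto_ofReal (((Tendsto.mul_const _ ?_)).mul_const _)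
      rw [← Real.rpow_neg_one p]
      have h0 : Tendsto (fun n => ε n - 1) atTop (𝓝 (-1)) := by
        have := (tendsto_nhds_of_tendsto_nhdsWithin hεt).sub_const 1
        simpa using this
      exact (Real.continuousAt_const_rpow hp0.ne').tendsto.comp h0
  refine hconv.congr fun n => ?_
  rw [hint, ← ENNReal.ofReal_sub _ (beta_pos (hε n) hcr).le]
  rfl

/-! ### Integrals with respect to the Lévy measure -/

section Levy

variable {Ω : Type*} [MeasurableSpace Ω] {B₀ : Measure Ω} [IsFiniteMeasure B₀] {c : ℝ}

lemma lintegral_betaLevy {f : ℝ → ℝ≥0∞} (hf : Measurable f) :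
    ∫⁻ y, f y.1 ∂betaLevy c B₀ = B₀ Set.univ *
      ∫⁻ p in Set.Ioo (0 : ℝ) 1, ENNReal.ofReal (p⁻¹ * (1 - p) ^ (c - 1)) * f p := by
  rw [betaLevy, MeasureTheory.lintegral_prod (fun y : ℝ × Ω => f y.1)
    (hf.comp measurable_fst).aemeasurable]
  simp only [lintegral_const]
  rw [lintegral_mul_const _ hf, lintegral_withDensity_eq_lintegral_mul _ (by fun_prop) hf, mul_comm]
  rfl

lemma lintegral_betaLevy_pow_mul_rpow (hc : 0 < c) {r : ℝ} (hr : 0 ≤ r) {n : ℕ} (hn : 1 ≤ n) :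
    ∫⁻ y, ENNReal.ofReal (y.1 ^ n) * ENNReal.ofReal ((1 - y.1) ^ r) ∂betaLevy c B₀ =
      B₀ Set.univ * ENNReal.ofReal (beta n (c + r)) := by
  rw [lintegral_betaLevy (f := fun p => ENNReal.ofReal (p ^ n) * ENNReal.ofReal ((1 - p) ^ r))
    (by fun_prop), ← lintegral_Ioo_beta (by exact_mod_cast hn) (by linarith : 0 < c + r)]
  congr 1
  refine setLIntegral_congr_fun measurableSet_Ioo fun p hp => ?_
  have hp0 := hp.1
  have hp1 : 0 < 1 - p := sub_pos.2 hp.2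
  rw [← ENNReal.ofReal_mul (by positivity), ← ENNReal.ofReal_mul (by positivity)]
  congr 1
  rw [show c + r - 1 = (c - 1) + r by ring, Real.rpow_add hp1, Real.rpow_sub_one hp0.ne',
    Real.rpow_natCast]
  field_simp

lemma lintegral_betaLevy_one_sub_rpow (hc : 0 < c) {r : ℝ} (hr : 0 ≤ r) :
    ∫⁻ y, (1 - ENNReal.ofReal ((1 - y.1) ^ r)) ∂betaLevy c B₀ =
      B₀ Set.univ * ENNReal.ofReal (digamma (c + r) - digamma c) := by
  rw [lintegral_betaLevy (f := fun p => 1 - ENNReal.ofReal ((1 - p) ^ r)) (by fun_prop),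
    ← (lintegral_one_sub_rpow_eq_digamma_sub hc hr).2]
  congr 1
  refine setLIntegral_congr_fun measurableSet_Ioo fun p hp => ?_
  have hp0 := hp.1
  have hp1 : 0 < 1 - p := sub_pos.2 hp.2
  rw [← ENNReal.ofReal_one, ← ENNReal.ofReal_sub _ (by positivity),
    ← ENNReal.ofReal_mul (by positivity)]

lemma betaLevy_compl_Ioo : betaLevy c B₀ ((Set.Ioo (0 : ℝ) 1)ᶜ ×ˢ Set.univ) = 0 := by
  rw [betaLevy, Measure.prod_prod, withDensity_apply _ measurableSet_Ioo.compl,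
    Measure.restrict_restrict measurableSet_Ioo.compl]
  simp

end Levy

/-! ### Labellings inducing a given partition -/

section Labels

variable {D L : Type*} [Fintype D] [DecidableEq D]

/-- The labelling giving the points of the block `A` the label `e A`. -/
def labelOf (π : Finpartition (Finset.univ : Finset D)) (e : π.parts ↪ L) (a : D) : L :=
  e ⟨π.part a, π.part_mem.2 (Finset.mem_univ a)⟩

lemma labelOf_eq_iff (π : Finpartition (Finset.univ : Finset D)) (e : π.parts ↪ L) (a : D)
    (A : π.parts) : labelOf π e a = e A ↔ a ∈ A.1 := by
  rw [labelOf, e.injective.eq_iff, Subtype.ext_iff]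
  exact π.part_eq_iff_mem A.2

lemma exists_mem_block (π : Finpartition (Finset.univ : Finset D)) (A : π.parts) :
    ∃ a, a ∈ A.1 :=
  π.nonempty_of_mem_parts A.2

/-- The labellings with the blocks of `π` as level sets are the injections from the blocks to the
labels. -/
def labelEquiv (π : Finpartition (Finset.univ : Finset D)) (L : Type*) :
    (π.parts ↪ L) ≃ {l : D → L // ∀ a b, b ∈ π.part a ↔ l a = l b} :=
  Equiv.ofBijective (fun e => ⟨labelOf π e, fun a b => by
      rw [eq_comm, ← labelOf_eq_iff π e b ⟨π.part a, π.part_mem.2 (Finset.mem_univ a)⟩]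
      rfl⟩) <| by
    constructor
    · intro e e' h
      ext A
      obtain ⟨a, ha⟩ := exists_mem_block π A
      have h1 : labelOf π e a = labelOf π e' a := congrFun (congrArg Subtype.val h) a
      rwa [(labelOf_eq_iff π e a A).2 ha, (labelOf_eq_iff π e' a A).2 ha] at h1
    · rintro ⟨l, hl⟩
      choose q hq using exists_mem_block π
      have hpart : ∀ A : π.parts, π.part (q A) = A.1 := fun A => π.part_eq_of_mem A.2 (hq A)
      refine ⟨⟨fun A => l (q A), fun A A' h => Subtype.ext ?_⟩, Subtype.ext (funext fun a => ?_)⟩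
      · have := (hl (q A) (q A')).2 h
        rw [hpart] at this
        rw [← hpart A', π.part_eq_of_mem A.2 this]
      · exact (hl _ a).1 (by rw [hpart]; exact π.mem_part (Finset.mem_univ a))

end Labels

/-- A partition is determined by the block of each point. -/
lemma clusters_eq_iff {J : ℕ} {n : Fin J → ℕ} (l : DataPoint n → ℕ)
    (π : Finpartition (Finset.univ : Finset (DataPoint n))) :
    clusters n l = π ↔ ∀ a b, b ∈ π.part a ↔ l a = l b := by
  have hpart : ∀ a b, b ∈ (clusters n l).part a ↔ l a = l b := fun a b => by
    classical
    rw [clusters, Finpartition.mem_part_ofSetoid_iff_rel]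
    rfl
  constructor
  · rintro rfl
    exact hpart
  · intro h
    have h1 : ∀ a, (clusters n l).part a = π.part a := fun a => by
      ext b; rw [hpart, h]
    ext A
    constructor
    · intro hA
      obtain ⟨a, ha⟩ := (clusters n l).nonempty_of_mem_parts hA
      rw [← (clusters n l).part_eq_of_mem hA ha, h1]
      exact π.part_mem.2 (Finset.mem_univ a)
    · intro hA
      obtain ⟨a, ha⟩ := π.nonempty_of_mem_parts hA
      rw [← π.part_eq_of_mem hA ha, ← h1]
      exact (clusters n l).part_mem.2 (Finset.mem_univ a)

/-! ### Counting labellings with given level set sizes -/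

section Counting

lemma prod_X_eq_monomial {N : ℕ} {L : Type*} [Fintype L] [DecidableEq L] (t : Fin N → L) :
    ∏ i, (MvPolynomial.X (t i) : MvPolynomial L ℕ) =
      MvPolynomial.monomial (Finsupp.equivFunOnFinite.symm
        fun k => (Finset.univ.filter fun i => t i = k).card) 1 := by
  rw [MvPolynomial.monomial_eq, Finsupp.prod_fintype _ _ (by simp), map_one, one_mul,
    ← Finset.prod_fiberwise (s := Finset.univ) t]
  refine Finset.prod_congr rfl fun k _ => ?_
  rw [Finset.prod_congr rfl (g := fun _ => MvPolynomial.X k)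
    (fun i hi => by rw [(Finset.mem_filter.1 hi).2]), Finset.prod_const]
  rfl

/-- The power of a sum of variables is expanded once over all functions `Fin N → L` and once by the
multinomial theorem; the coefficients of the monomial with exponents `u` must agree. -/
lemma card_fiber_card_eq {N : ℕ} {L : Type*} [Fintype L] [DecidableEq L] (u : L → ℕ)
    (hu : ∑ k, u k = N) :
    (Finset.univ.filter fun t : Fin N → L =>
      (fun k => (Finset.univ.filter fun i => t i = k).card) = u).card * ∏ k, (u k).factorial =
      N.factorial := by
  have h1 := congrArg (MvPolynomial.coeff (Finsupp.equivFunOnFinite.symm u))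
    (Finset.sum_pow_eq_sum_piAntidiag Finset.univ
      (fun k : L => (MvPolynomial.X k : MvPolynomial L ℕ)) N)
  rw [Fintype.sum_pow] at h1
  simp_rw [prod_X_eq_monomial] at h1
  rw [MvPolynomial.coeff_sum, MvPolynomial.coeff_sum] at h1
  have h2 : ∀ w : L → ℕ, ∏ k, (MvPolynomial.X k : MvPolynomial L ℕ) ^ w k =
      MvPolynomial.monomial (Finsupp.equivFunOnFinite.symm w) 1 := fun w => by
    rw [MvPolynomial.monomial_eq, Finsupp.prod_fintype _ _ (by simp), map_one, one_mul]
    rfl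
  simp_rw [h2, MvPolynomial.coeff_monomial, EmbeddingLike.apply_eq_iff_eq] at h1
  rw [Finset.sum_boole] at h1
  have h3 : ∀ w : L → ℕ, MvPolynomial.coeff (Finsupp.equivFunOnFinite.symm u)
      ((Nat.multinomial Finset.univ w : MvPolynomial L ℕ) *
        MvPolynomial.monomial (Finsupp.equivFunOnFinite.symm w) 1) =
      if w = u then Nat.multinomial Finset.univ w else 0 := fun w => by
    rw [← map_natCast (MvPolynomial.C (σ := L) (R := ℕ)), MvPolynomial.coeff_C_mul,
      MvPolynomial.coeff_monomial]
    simp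
  simp_rw [h3] at h1
  rw [Finset.sum_ite_eq', if_pos (by simp [hu])] at h1
  have h4 := Nat.multinomial_spec Finset.univ u
  rw [hu, mul_comm] at h4
  rw [← h4]
  congr 1

variable {J : ℕ} {n : Fin J → ℕ}

/-- The count vectors of the level sets of a labelling. -/
def fiberSizes {L : Type*} [DecidableEq L] (l : DataPoint n → L) (k : L) : Fin J → ℕ :=
  clusterSize (Finset.univ.filter fun a => l a = k)

lemma fiberSizes_apply {L : Type*} [DecidableEq L] (l : DataPoint n → L) (k : L) (j : Fin J) :
    fiberSizes l k j = (Finset.univ.filter fun i : Fin (n j) => l ⟨j, i⟩ = k).card := by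
  rw [fiberSizes, clusterSize, Finset.filter_filter]
  symm
  refine Finset.card_bij (fun i _ => ⟨j, i⟩) (by simp) (by simp) ?_
  rintro ⟨j', i⟩ h
  simp only [Finset.mem_filter, Finset.mem_univ, true_and] at h
  obtain ⟨h1, rfl⟩ := h
  exact ⟨i, by simpa using h1, rfl⟩

lemma fiberSizes_labelOf {L : Type*} [DecidableEq L]
    (π : Finpartition (Finset.univ : Finset (DataPoint n))) (e : π.parts ↪ L) (A : π.parts) :
    fiberSizes (labelOf π e) (e A) = clusterSize A.1 := by
  rw [fiberSizes]
  congr 1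
  ext a
  simp [labelOf_eq_iff]

lemma fiberSizes_labelOf_of_notMem {L : Type*} [DecidableEq L]
    (π : Finpartition (Finset.univ : Finset (DataPoint n))) (e : π.parts ↪ L) {k : L}
    (hk : ∀ A, e A ≠ k) : fiberSizes (labelOf π e) k = 0 := by
  have h1 : (Finset.univ.filter fun a => labelOf π e a = k) = ∅ :=
    Finset.filter_eq_empty_iff.2 fun a _ => hk _
  rw [fiberSizes, h1]
  rfl

/-- A product over the labels depending on the sizes of the level sets is a product over the
blocks. -/
lemma prod_range_fiberSizes {M : Type*} [CommMonoid M]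
    (π : Finpartition (Finset.univ : Finset (DataPoint n))) (e : π.parts ↪ ℕ)
    (H : ℕ → (Fin J → ℕ) → M) (hH : ∀ k, H k 0 = 1) {N : ℕ} (hN : ∀ A, e A < N) :
    ∏ k ∈ Finset.range N, H k (fiberSizes (labelOf π e) k) = ∏ A, H (e A) (clusterSize A.1) := by
  have h1 : ∏ k ∈ Finset.univ.map e, H k (fiberSizes (labelOf π e) k) =
      ∏ k ∈ Finset.range N, H k (fiberSizes (labelOf π e) k) := by
    refine Finset.prod_subset (fun k hk => ?_) fun k _ hk => ?_
    · obtain ⟨A, -, rfl⟩ := Finset.mem_map.1 hk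
      exact Finset.mem_range.2 (hN A)
    · rw [fiberSizes_labelOf_of_notMem π e fun A hA => hk (Finset.mem_map.2 ⟨A, by simp, hA⟩), hH]
  rw [← h1, Finset.prod_map]
  simp_rw [fiberSizes_labelOf]

/-- A product over the data points regrouped by blocks and groups. -/
lemma prod_labelOf {L M : Type*} [CommMonoid M]
    (π : Finpartition (Finset.univ : Finset (DataPoint n))) (e : π.parts ↪ L)
    (w : Fin J → L → M) :
    ∏ a : DataPoint n, w a.1 (labelOf π e a) = ∏ A, ∏ j, w j (e A) ^ clusterSize A.1 j := by
  classical
  rw [← Finset.prod_fiberwise (s := Finset.univ)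
    fun a => (⟨π.part a, π.part_mem.2 (Finset.mem_univ a)⟩ : π.parts)]
  refine Finset.prod_congr rfl fun A _ => ?_
  have h1 : (Finset.univ.filter fun a : DataPoint n =>
      (⟨π.part a, π.part_mem.2 (Finset.mem_univ a)⟩ : π.parts) = A) = A.1 := by
    ext a
    simp only [Finset.mem_filter, Finset.mem_univ, true_and, Subtype.ext_iff]
    exact π.part_eq_iff_mem A.2
  rw [h1, Finset.prod_congr rfl (g := fun a => w a.1 (e A))
    fun a ha => by rw [(labelOf_eq_iff π e a A).2 ha],
    ← Finset.prod_fiberwise (s := A.1) (fun a => a.1)]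
  refine Finset.prod_congr rfl fun j _ => ?_
  rw [Finset.prod_congr rfl (g := fun _ => w j (e A))
    (fun a ha => by rw [(Finset.mem_filter.1 ha).2]), Finset.prod_const, clusterSize]

lemma sum_fiberSizes {K : ℕ} (l : DataPoint n → Fin K) : ∑ k, fiberSizes l k = n := by
  funext j
  rw [Finset.sum_apply]
  simp_rw [fiberSizes_apply]
  rw [← Finset.card_eq_sum_card_fiberwise (fun _ _ => Finset.mem_univ _)]
  simp

lemma sum_clusterSize (A : Finset (DataPoint n)) : ∑ j, clusterSize A j = A.card := by
  simp_rw [clusterSize]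
  rw [← Finset.card_eq_sum_card_fiberwise (fun _ _ => Finset.mem_univ _)]

/-- The box in the definition only ensures finiteness: summands of `n` are bounded by `n` anyway. -/
lemma mem_decompositions {K : ℕ} {v : Fin K → Fin J → ℕ} :
    v ∈ decompositions n K ↔ ∑ k, v k = n ∧ ∀ k, 1 ≤ ∑ j, v k j := by
  rw [decompositions, Finset.mem_filter, and_iff_right_iff_imp]
  rintro ⟨rfl, -⟩
  refine Fintype.mem_piFinset.2 fun k => Finset.mem_Iic.2 ?_
  exact Finset.single_le_sum (f := v) (fun _ _ => zero_le) (Finset.mem_univ k)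

lemma fiberSizes_mem_decompositions {K : ℕ} (l : DataPoint n → Fin K) :
    fiberSizes l ∈ decompositions n K ↔ Function.Surjective l := by
  rw [mem_decompositions, and_iff_right (sum_fiberSizes l)]
  refine forall_congr' fun k => ?_
  rw [fiberSizes, sum_clusterSize, Finset.one_le_card]
  simp [Finset.Nonempty]

/-- A labelling of the data points is an independent choice of a labelling in each group, so the
count is a product of multinomial coefficients. -/
lemma card_fiberSizes_eq {K : ℕ} {v : Fin K → Fin J → ℕ} (hv : v ∈ decompositions n K) :
    (Finset.univ.filter fun l : DataPoint n → Fin K => fiberSizes l = v).card *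
      ∏ k, ∏ j, (v k j).factorial = ∏ j, (n j).factorial := by
  have hsum : ∀ j, ∑ k, v k j = n j := fun j => by
    rw [← (mem_decompositions.1 hv).1, Finset.sum_apply]
  rw [Finset.prod_comm]
  simp_rw [← card_fiber_card_eq (fun k => v k _) (hsum _)]
  rw [Finset.prod_mul_distrib]
  congr 1
  rw [← Fintype.card_piFinset]
  refine Finset.card_bij (fun l _ j i => l ⟨j, i⟩) ?_ ?_ ?_
  · intro l hl
    refine Fintype.mem_piFinset.2 fun j => Finset.mem_filter.2 ⟨Finset.mem_univ _, funext fun k => ?_⟩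
    rw [← fiberSizes_apply, (Finset.mem_filter.1 hl).2]
  · intro l _ l' _ h
    funext ⟨j, i⟩
    exact congrFun (congrFun h j) i
  · intro t ht
    refine ⟨fun a => t a.1 a.2, Finset.mem_filter.2 ⟨Finset.mem_univ _, ?_⟩, rfl⟩
    funext k j
    rw [fiberSizes_apply]
    exact congrFun (Finset.mem_filter.1 (Fintype.mem_piFinset.1 ht j)).2 k

/-- A partition with `K` blocks is the level set partition of exactly `K!` surjections, one for each
bijection from its blocks to `Fin K`. -/
lemma sum_surjective_eq_sum_partitions (W : (Fin J → ℕ) → ℝ) (K : ℕ) :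
    ∑ l : DataPoint n → Fin K with Function.Surjective l, ∏ k, W (fiberSizes l k) =
      K.factorial * ∑ π : Finpartition (Finset.univ : Finset (DataPoint n)) with
        π.parts.card = K, ∏ A ∈ π.parts, W (clusterSize A) := by
  classical
  rw [← Finset.sum_fiberwise (s := Finset.univ.filter Function.Surjective)
    (fun l : DataPoint n → Fin K => clusters n fun a => (l a : ℕ)), Finset.mul_sum,
    Finset.sum_filter]
  refine Finset.sum_congr rfl fun π _ => ?_
  have hker : ∀ l : DataPoint n → Fin K, clusters n (fun a => (l a : ℕ)) = π ↔
      ∀ a b, b ∈ π.part a ↔ l a = l b := fun l => by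
    rw [clusters_eq_iff]; simp_rw [Fin.val_inj]
  split_ifs with hK
  · have hbij : ∀ e : π.parts ↪ Fin K, Function.Bijective e := fun e =>
      (Fintype.bijective_iff_injective_and_card e).2 ⟨e.injective, by simp [hK]⟩
    have hterm : ∀ e : π.parts ↪ Fin K,
        ∏ k, W (fiberSizes (labelOf π e) k) = ∏ A ∈ π.parts, W (clusterSize A) := by
      intro e
      rw [← (hbij e).prod_comp, ← Finset.prod_coe_sort π.parts fun A => W (clusterSize A)]
      refine Finset.prod_congr rfl fun A _ => ?_
      rw [fiberSizes_labelOf]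
    have hset : (Finset.univ.filter Function.Surjective).filter
        (fun l : DataPoint n → Fin K => clusters n (fun a => (l a : ℕ)) = π) =
        Finset.univ.image fun e : π.parts ↪ Fin K => labelOf π e := by
      ext l
      simp only [Finset.mem_filter, Finset.mem_univ, true_and, Finset.mem_image]
      rw [hker]
      constructor
      · rintro ⟨-, hl⟩
        obtain ⟨e, he⟩ := (labelEquiv π (Fin K)).surjective ⟨l, hl⟩
        exact ⟨e, congrArg Subtype.val he⟩
      · rintro ⟨e, rfl⟩
        refine ⟨fun k => ?_, (labelEquiv π (Fin K) e).2⟩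
        obtain ⟨A, rfl⟩ := (hbij e).2 k
        obtain ⟨a, ha⟩ := exists_mem_block π A
        exact ⟨a, (labelOf_eq_iff π e a A).2 ha⟩
    rw [hset, Finset.sum_image]
    · simp_rw [hterm]
      rw [Finset.sum_const, nsmul_eq_mul, Finset.card_univ, Fintype.card_embedding_eq]
      simp [hK, Nat.descFactorial_self]
    · intro e _ e' _ h
      exact (labelEquiv π (Fin K)).injective (Subtype.ext h)
  · refine Finset.sum_eq_zero fun l hl => (hK ?_).elim
    simp only [Finset.mem_filter, Finset.mem_univ, true_and] at hl
    obtain ⟨e, he⟩ := (labelEquiv π (Fin K)).surjective ⟨l, (hker l).1 hl.2⟩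
    have he' : labelOf π e = l := congrArg Subtype.val he
    have hsurj : Function.Surjective e := fun k => by
      obtain ⟨a, rfl⟩ := hl.1 k
      exact ⟨_, congrFun he' a⟩
    simpa using Fintype.card_of_bijective ⟨e.injective, hsurj⟩

/-- The same sum is grouped by the level set count vectors instead. These form a decomposition with
nonzero parts exactly because the labelling is surjective. -/
lemma sum_surjective_eq_sum_decompositions (W : (Fin J → ℕ) → ℝ) (K : ℕ) :
    ∑ l : DataPoint n → Fin K with Function.Surjective l, ∏ k, W (fiberSizes l k) =
      (∏ j, ((n j).factorial : ℝ)) *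
        ∑ v ∈ decompositions n K, ∏ k, (W (v k) / ∏ j, ((v k j).factorial : ℝ)) := by
  classical
  rw [← Finset.sum_fiberwise_of_maps_to (s := Finset.univ.filter Function.Surjective)
    (t := decompositions n K) (g := fiberSizes)
    (fun l hl => (fiberSizes_mem_decompositions l).2 (Finset.mem_filter.1 hl).2), Finset.mul_sum]
  refine Finset.sum_congr rfl fun v hv => ?_
  have hset : (Finset.univ.filter Function.Surjective).filter
      (fun l : DataPoint n → Fin K => fiberSizes l = v) =
      Finset.univ.filter fun l => fiberSizes l = v := by
    ext l
    simp only [Finset.mem_filter, Finset.mem_univ, true_and, and_iff_right_iff_imp]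
    rintro rfl
    exact (fiberSizes_mem_decompositions l).1 hv
  rw [hset, Finset.sum_congr rfl (g := fun _ => ∏ k, W (v k))
    (fun l hl => by rw [(Finset.mem_filter.1 hl).2]), Finset.sum_const, nsmul_eq_mul,
    Finset.prod_div_distrib]
  have hcard : ((Finset.univ.filter fun l : DataPoint n → Fin K => fiberSizes l = v).card : ℝ) *
      ∏ k, ∏ j, ((v k j).factorial : ℝ) = ∏ j, ((n j).factorial : ℝ) := by
    exact_mod_cast card_fiberSizes_eq hv
  rw [← hcard]
  have : ∏ k, ∏ j, ((v k j).factorial : ℝ) ≠ 0 := by positivity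
  field_simp

theorem sum_eppfNumerator (r : Fin J → ℝ) (c γ₀ : ℝ) (hn : 1 ≤ ∑ j, n j) :
    ∑ π : Finpartition (Finset.univ : Finset (DataPoint n)), eppfNumerator r c γ₀ n π =
      eppfDenominator r c γ₀ n := by
  classical
  let W : (Fin J → ℕ) → ℝ := fun v => columnTotalWeight r c v *
    ∏ j, Real.Gamma (v j + r j) / Real.Gamma (r j)
  have hcardD : (Finset.univ : Finset (DataPoint n)).card = ∑ j, n j := by
    simp [Finset.card_univ, Fintype.card_sigma]
  -- The partitions are grouped by their number `K` of blocks; `K ≥ 1` because there is at least one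
  -- data point.
  rw [← Finset.sum_fiberwise_of_maps_to (s := Finset.univ) (t := Finset.Icc 1 (∑ j, n j))
    (g := fun π : Finpartition (Finset.univ : Finset (DataPoint n)) => π.parts.card)]
  · rw [eppfDenominator]
    refine Finset.sum_congr rfl fun K _ => ?_
    have h1 := (sum_surjective_eq_sum_partitions (n := n) W K).symm.trans
      (sum_surjective_eq_sum_decompositions W K)
    have h2 : ∑ v ∈ decompositions n K, ∏ k, (columnTotalWeight r c (v k) *
        ∏ j, Real.Gamma (v k j + r j) / ((v k j).factorial * Real.Gamma (r j))) =
        ∑ v ∈ decompositions n K, ∏ k, (W (v k) / ∏ j, ((v k j).factorial : ℝ)) := by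
      refine Finset.sum_congr rfl fun v _ => Finset.prod_congr rfl fun k _ => ?_
      simp only [W]
      rw [mul_div_assoc, ← Finset.prod_div_distrib]
      congr 1
      refine Finset.prod_congr rfl fun j _ => ?_
      rw [div_div, mul_comm (Real.Gamma (r j))]
    rw [h2]
    have h3 : ∀ π ∈ (Finset.univ : Finset (Finpartition (Finset.univ : Finset (DataPoint n)))).filter
        (fun π => π.parts.card = K), eppfNumerator r c γ₀ n π =
        γ₀ ^ K / (∏ j, ((n j).factorial : ℝ)) * ∏ A ∈ π.parts, W (clusterSize A) := fun π hπ => by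
      rw [eppfNumerator, (Finset.mem_filter.1 hπ).2]
    rw [Finset.sum_congr rfl h3, ← Finset.mul_sum]
    have hK : (K.factorial : ℝ) ≠ 0 := by positivity
    have hN : ∏ j, ((n j).factorial : ℝ) ≠ 0 := by positivity
    rw [div_mul_eq_mul_div, div_mul_eq_mul_div, div_eq_div_iff hN hK]
    linear_combination γ₀ ^ K * h1
  · intro π _
    rw [Finset.mem_Icc]
    constructor
    · rw [Finset.one_le_card]
      have : (Finset.univ : Finset (DataPoint n)).Nonempty := by
        rw [← Finset.one_le_card, hcardD]; exact hn
      obtain ⟨a, ha⟩ := this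
      exact ⟨_, π.part_mem.2 ha⟩
    · rw [← hcardD]
      exact π.card_parts_le_card

/-! ### Positivity and symmetry of the numerator -/

lemma columnTotalWeight_pos {r : Fin J → ℝ} {c : ℝ} (hc : 0 < c) (hr : ∀ j, 0 < r j)
    {v : Fin J → ℕ} (hv : 1 ≤ ∑ j, v j) : 0 < columnTotalWeight r c v := by
  have h1 : (0 : ℝ) < ∑ j, (v j : ℝ) := by exact_mod_cast hv
  have h2 : 0 ≤ ∑ j, r j := Finset.sum_nonneg fun j _ => (hr j).le
  rw [columnTotalWeight]
  have := Real.Gamma_pos_of_pos h1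
  have := Real.Gamma_pos_of_pos (by linarith : 0 < c + ∑ j, r j)
  have := Real.Gamma_pos_of_pos (by linarith : 0 < c + ∑ j, (v j : ℝ) + ∑ j, r j)
  positivity

lemma one_le_sum_clusterSize {π : Finpartition (Finset.univ : Finset (DataPoint n))}
    {A : Finset (DataPoint n)} (hA : A ∈ π.parts) : 1 ≤ ∑ j, clusterSize A j := by
  rw [sum_clusterSize, Finset.one_le_card]
  exact π.nonempty_of_mem_parts hA

lemma eppfNumerator_pos {r : Fin J → ℝ} {c γ₀ : ℝ} (hc : 0 < c) (hr : ∀ j, 0 < r j)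
    (hγ : 0 < γ₀) (π : Finpartition (Finset.univ : Finset (DataPoint n))) :
    0 < eppfNumerator r c γ₀ n π := by
  refine mul_pos (by positivity) (Finset.prod_pos fun A hA => ?_)
  refine mul_pos (columnTotalWeight_pos hc hr (one_le_sum_clusterSize hA))
    (Finset.prod_pos fun j _ => div_pos ?_ (Real.Gamma_pos_of_pos (hr j)))
  exact Real.Gamma_pos_of_pos (add_pos_of_nonneg_of_pos (Nat.cast_nonneg _) (hr j))

lemma eppfNumerator_congr (r : Fin J → ℝ) (c γ₀ : ℝ)
    {π π' : Finpartition (Finset.univ : Finset (DataPoint n))}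
    (h : π.parts.val.map clusterSize = π'.parts.val.map clusterSize) :
    eppfNumerator r c γ₀ n π = eppfNumerator r c γ₀ n π' := by
  have h1 : ∀ W : (Fin J → ℕ) → ℝ, ∀ ρ : Finpartition (Finset.univ : Finset (DataPoint n)),
      ∏ A ∈ ρ.parts, W (clusterSize A) = ((ρ.parts.val.map clusterSize).map W).prod := by
    intro W ρ
    rw [Multiset.map_map]
    rfl
  have h2 : π.parts.card = π'.parts.card := by
    simpa using congrArg Multiset.card h
  rw [eppfNumerator, eppfNumerator, h2,
    h1 (fun v => columnTotalWeight r c v * ∏ j, Real.Gamma (v j + r j) / Real.Gamma (r j)), h, ← h1]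

end Counting

section Model

variable {S Ω : Type*} [MeasurableSpace S] [MeasurableSpace Ω] {J : ℕ} {P : Measure S}
  {r : Fin J → ℝ} {c : ℝ} {B₀ : Measure Ω}
  {atom : ℕ → S → ℝ × Ω} {θ : Fin J → ℕ → S → ℝ} {m : Fin J → S → ℕ} {z : Fin J → ℕ → S → ℕ}

/-! ### Almost sure properties of the model -/

lemma IsModel.measurable_atoms (h : IsModel P r c B₀ atom θ m z) :
    Measurable fun s k => atom k s :=
  measurable_pi_iff.2 h.beta_process.measurable

lemma measurable_gamma_kernel (r : Fin J → ℝ) (jk : Fin J × ℕ) :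
    Measurable fun a : ℕ → ℝ × Ω =>
      gammaMeasure (r jk.1) ((1 - (a jk.2).1) / (a jk.2).1) :=
  (measurable_gammaMeasure (r jk.1)).comp
    (f := fun a : ℕ → ℝ × Ω => (1 - (a jk.2).1) / (a jk.2).1) (by fun_prop)

lemma IsModel.ae_weight_nonneg (h : IsModel P r c B₀ atom θ m z) :
    ∀ᵐ s ∂P, ∀ j k, 0 ≤ θ j k s := by
  refine ae_all_iff.2 fun j => ae_all_iff.2 fun k => ?_
  have h1 := h.gamma_process {(j, k)} Set.univ (fun _ => Set.Iio 0) MeasurableSet.univ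
    (fun _ => measurableSet_Iio)
  simp only [Finset.prod_singleton, gammaMeasure_Iio_zero, lintegral_zero, Set.mem_univ, true_and,
    Finset.mem_singleton, forall_eq, Set.mem_Iio] at h1
  rw [ae_iff]
  simpa only [not_le] using h1

variable [IsProbabilityMeasure P] [IsFiniteMeasure B₀]

/-- The number of atoms with weight outside `(0, 1)` is Poisson with mean 0. -/
lemma IsModel.ae_mem_Ioo (h : IsModel P r c B₀ atom θ m z) :
    ∀ᵐ s ∂P, ∀ k, (atom k s).1 ∈ Set.Ioo (0 : ℝ) 1 := by
  let A : Set (ℝ × Ω) := (Set.Ioo (0 : ℝ) 1)ᶜ ×ˢ Set.univ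
  have hA : MeasurableSet A := measurableSet_Ioo.compl.prod MeasurableSet.univ
  have hν : betaLevy c B₀ A = 0 := betaLevy_compl_Ioo
  have h1 := h.beta_process.measure_encard_eq (T := Unit) (fun _ => A) (fun _ => hA)
    (fun _ => by rw [hν]; exact ENNReal.zero_ne_top) (fun a b hab => (hab rfl).elim) (fun _ => 0)
  have h2 : P {s | {k | atom k s ∈ A}.encard = 0} = 1 := by
    simpa [hν, poissonMeasure_singleton] using h1
  have hm : MeasurableSet {s | {k | atom k s ∈ A}.encard = 0} :=
    measurable_encard h.beta_process.measurable hA (measurableSet_singleton 0)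
  have h3 : ∀ᵐ s ∂P, s ∈ {s | {k | atom k s ∈ A}.encard = 0} := by
    rw [← prob_compl_eq_zero_iff hm] at h2
    exact h2
  filter_upwards [h3] with s hs k
  by_contra hk
  have hempty : {k | atom k s ∈ A} = ∅ := Set.encard_eq_zero.1 hs
  have : k ∈ {k | atom k s ∈ A} := ⟨hk, Set.mem_univ _⟩
  rw [hempty] at this
  exact this

lemma lintegral_betaLevy_fst_ne_top (hc : 0 < c) :
    ∫⁻ y, ENNReal.ofReal y.1 ∂betaLevy c B₀ ≠ ⊤ := by
  have h1 := lintegral_betaLevy_pow_mul_rpow (B₀ := B₀) hc le_rfl (le_refl 1)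
  simp only [pow_one, Real.rpow_zero, ENNReal.ofReal_one, mul_one] at h1
  rw [h1]
  exact ENNReal.mul_ne_top (measure_ne_top _ _) ENNReal.ofReal_ne_top

/-- This is the Campbell–Mecke formula for a single point with `φ = 0`. -/
lemma IsModel.lintegral_tsum_atom_ne_top (h : IsModel P r c B₀ atom θ m z) (hc : 0 < c) :
    ∫⁻ s, ∑' k, ENNReal.ofReal (atom k s).1 ∂P ≠ ⊤ := by
  have h1 := h.beta_process.lintegral_tsum_embedding (I := Unit)
    (fun _ y => ENNReal.ofReal y.1) (fun _ => 0) (fun _ => by fun_prop)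
    (fun _ _ => ENNReal.ofReal_ne_top) (fun _ => lintegral_betaLevy_fst_ne_top hc) (by fun_prop)
    (by simp) (by simp)
  simp only [Finset.univ_unique, Finset.prod_singleton, tsub_zero, tprod_one, mul_one,
    lintegral_zero, ENNReal.toReal_zero, neg_zero, Real.exp_zero, ENNReal.ofReal_one] at h1
  have h2 : ∀ s, ∑' e : Unit ↪ ℕ, ENNReal.ofReal (atom (e default) s).1 =
      ∑' k, ENNReal.ofReal (atom k s).1 := fun s =>
    Equiv.uniqueEmbeddingEquivResult.tsum_eq fun k => ENNReal.ofReal (atom k s).1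
  simp_rw [h2] at h1
  rw [h1]
  exact lintegral_betaLevy_fst_ne_top hc

/-- The conditional mean `r j * p / (1 - p)` of a weight need not have a finite expected sum,
because of atoms near `p = 1`. Almost surely only finitely many atoms exceed `1 / 2`. For the others
the conditional mean is at most `2 * r j * p`, and `p` has a finite expected sum. Summability
matters because `tsum` defaults to 0 without it. -/
lemma IsModel.ae_summable (h : IsModel P r c B₀ atom θ m z) (hc : 0 < c) (hr : ∀ j, 0 < r j) :
    ∀ᵐ s ∂P, ∀ j, Summable fun k => θ j k s := by
  refine ae_all_iff.2 fun j => ?_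
  let A : Set (ℝ × Ω) := Set.Ioi (1 / 2 : ℝ) ×ˢ Set.univ
  have hA : MeasurableSet A := measurableSet_Ioi.prod MeasurableSet.univ
  have hνA : betaLevy c B₀ A ≠ ⊤ := by
    have h1 : betaLevy c B₀ A ≤ ∫⁻ y, 2 * ENNReal.ofReal y.1 ∂betaLevy c B₀ := by
      rw [← lintegral_indicator_one hA]
      refine lintegral_mono fun y => ?_
      by_cases hy : y ∈ A
      · rw [Set.indicator_of_mem hy, Pi.one_apply, ← ENNReal.ofReal_ofNat 2,
          ← ENNReal.ofReal_mul zero_le_two, ENNReal.one_le_ofReal]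
        have : (1 / 2 : ℝ) < y.1 := hy.1
        linarith
      · rw [Set.indicator_of_notMem hy]
        exact zero_le
    refine ne_top_of_le_ne_top ?_ h1
    rw [lintegral_const_mul _ (by fun_prop)]
    exact ENNReal.mul_ne_top ENNReal.ofNat_ne_top (lintegral_betaLevy_fst_ne_top hc)
  have hfin := h.beta_process.ae_finite hA hνA
  let Es : ℕ → Set (ℕ → ℝ × Ω) := fun k => (fun a => a k) ⁻¹' Aᶜ
  have hEs : ∀ k, MeasurableSet (Es k) := fun k => measurable_pi_apply k hA.compl
  let X : S → ℕ → ℝ × Ω := fun s k => atom k s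
  have hX : Measurable X := h.measurable_atoms
  have hbound : ∀ k, ∫⁻ s in X ⁻¹' Es k, ENNReal.ofReal (θ j k s) ∂P ≤
      ENNReal.ofReal (2 * r j) * ∫⁻ s, ENNReal.ofReal (atom k s).1 ∂P := by
    intro k
    have h1 := h.gamma_process.lintegral_prod hX
      (fun jk => h.measurable_weight jk.1 jk.2) (measurable_gamma_kernel r) {(j, k)} (hEs k)
      (u := fun _ t => ENNReal.ofReal t) (fun _ => ENNReal.measurable_ofReal)
    simp only [Finset.prod_singleton] at h1
    rw [h1, ← lintegral_const_mul _ ((h.beta_process.measurable k).fst.ennreal_ofReal)]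
    refine (setLIntegral_mono_ae' (hX (hEs k)) ?_).trans (setLIntegral_le_lintegral (X ⁻¹' Es k) _)
    filter_upwards [h.ae_mem_Ioo] with s hs hsE
    have hp0 := (hs k).1
    have hp1 : 0 < 1 - (atom k s).1 := sub_pos.2 (hs k).2
    have hp : (atom k s).1 ≤ 1 / 2 := not_lt.1 fun hlt => hsE ⟨hlt, Set.mem_univ _⟩
    change ∫⁻ t, ENNReal.ofReal t ∂gammaMeasure (r j) ((1 - (atom k s).1) / (atom k s).1) ≤ _
    rw [lintegral_gammaMeasure_id (hr j) (div_pos hp1 hp0),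
      ← ENNReal.ofReal_mul (mul_pos two_pos (hr j)).le]
    refine ENNReal.ofReal_le_ofReal ?_
    rw [div_div_eq_mul_div, div_le_iff₀ hp1]
    nlinarith [mul_pos (hr j) hp0]
  have hsum : ∫⁻ s, ∑' k, (X ⁻¹' Es k).indicator (fun s => ENNReal.ofReal (θ j k s)) s ∂P ≠ ⊤ := by
    rw [lintegral_tsum fun k =>
      ((h.measurable_weight j k).ennreal_ofReal.indicator (hX (hEs k))).aemeasurable]
    refine ne_top_of_le_ne_top ?_ (ENNReal.tsum_le_tsum fun k =>
      (lintegral_indicator (hX (hEs k)) fun s => ENNReal.ofReal (θ j k s)).le.trans (hbound k))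
    rw [ENNReal.tsum_mul_left, ← lintegral_tsum fun k =>
      (h.beta_process.measurable k).fst.ennreal_ofReal.aemeasurable]
    exact ENNReal.mul_ne_top ENNReal.ofReal_ne_top (h.lintegral_tsum_atom_ne_top hc)
  have hmeas : Measurable fun s =>
      ∑' k, (X ⁻¹' Es k).indicator (fun s => ENNReal.ofReal (θ j k s)) s :=
    Measurable.tsum fun k => (h.measurable_weight j k).ennreal_ofReal.indicator (hX (hEs k))
  filter_upwards [hfin, ae_lt_top hmeas hsum, h.ae_weight_nonneg] with s hs1 hs2 hs3
  let R : Set ℕ := {k | atom k s ∈ A}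
  have h1 : Summable (R.indicator fun k => θ j k s) :=
    summable_of_hasFiniteSupport (hs1.subset Set.support_indicator_subset)
  have h2 : Summable (Rᶜ.indicator fun k => θ j k s) := by
    refine (ENNReal.summable_toReal hs2.ne).congr fun k => ?_
    by_cases hk : atom k s ∈ A
    · have hk1 : s ∉ X ⁻¹' Es k := fun hh => hh hk
      have hk2 : k ∉ Rᶜ := fun hh => hh hk
      rw [Set.indicator_of_notMem hk1, Set.indicator_of_notMem hk2, ENNReal.toReal_zero]
    · have hk1 : s ∈ X ⁻¹' Es k := hk
      have hk2 : k ∈ Rᶜ := hk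
      rw [Set.indicator_of_mem hk1, Set.indicator_of_mem hk2, ENNReal.toReal_ofReal (hs3 j k)]
  refine (h1.add h2).congr fun k => ?_
  exact congrFun (Set.indicator_self_add_compl R fun k => θ j k s) k

/-! ### The probability of a labelling -/

lemma categorical_singleton (t : ℕ → ℝ) (k : ℕ) :
    categorical t {k} = ENNReal.ofReal (t k / ∑' l, t l) := by
  rw [categorical, Measure.sum_smul_dirac_singleton]

/-- The `N`-th power of the total mass in the Poisson probability cancels the `N` normalisations of
the labels. -/
lemma poisson_mul_categorical {t : ℕ → ℝ} (ht : ∀ k, 0 ≤ t k) (hs : Summable t) (N : ℕ)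
    (l : Fin N → ℕ) :
    poissonMeasure (∑' k, t k).toNNReal {N} * ∏ i, categorical t {l i} =
      ENNReal.ofReal (1 / N.factorial) *
        (ENNReal.ofReal (Real.exp (-∑' k, t k)) * ∏ i, ENNReal.ofReal (t (l i))) := by
  have hT : 0 ≤ ∑' k, t k := tsum_nonneg ht
  simp_rw [categorical_singleton, poissonMeasure_singleton, Real.coe_toNNReal _ hT]
  set T := ∑' k, t k with hTdef
  rw [← ENNReal.ofReal_prod_of_nonneg fun i _ => ht _,
    ← ENNReal.ofReal_prod_of_nonneg fun i _ => div_nonneg (ht _) hT,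
    ← ENNReal.ofReal_mul (by positivity), ← ENNReal.ofReal_mul (by positivity),
    ← ENNReal.ofReal_mul (by positivity)]
  congr 1
  rw [Finset.prod_div_distrib, Finset.prod_const, Finset.card_univ, Fintype.card_fin]
  rcases eq_or_ne N 0 with rfl | hN
  · simp
  -- If the total mass is 0, all weights vanish and, as `N ≠ 0`, both sides are 0.
  rcases hT.eq_or_lt with h0 | h0
  · have hz : ∀ k, t k = 0 := fun k => by
      have := hs.le_tsum k fun k' _ => ht k'
      rw [← hTdef, ← h0] at this
      exact le_antisymm this (ht k)
    simp [hz, hN]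
  · field_simp

lemma IsModel.measure_labels (h : IsModel P r c B₀ atom θ m z) (hc : 0 < c) (hr : ∀ j, 0 < r j)
    (n : Fin J → ℕ) (l : DataPoint n → ℕ) :
    P {s | (∀ j, m j s = n j) ∧ ∀ a : DataPoint n, z a.1 a.2 s = l a} =
      (∏ j, ENNReal.ofReal (1 / (n j).factorial)) *
        ∫⁻ s, (∏ a : DataPoint n, ENNReal.ofReal (θ a.1 (l a) s)) *
          ∏ j, ENNReal.ofReal (Real.exp (-∑' k, θ j k s)) ∂P := by
  classical
  let ι : DataPoint n ↪ Fin J × ℕ := ⟨fun a => (a.1, (a.2 : ℕ)), by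
    rintro ⟨j, i⟩ ⟨j', i'⟩ hh
    simp only [Prod.mk.injEq] at hh
    obtain ⟨rfl, h2⟩ := hh
    rw [Fin.ext h2]⟩
  -- The sizes and the labels of actual data points are prescribed; labels with index `n j` or more
  -- are left free.
  let A : Fin J ⊕ Fin J × ℕ → Set ℕ := Sum.elim (fun j => {n j})
    (fun ji => if hi : ji.2 < n ji.1 then {l ⟨ji.1, ⟨ji.2, hi⟩⟩} else Set.univ)
  have hAr : ∀ a : DataPoint n, A (Sum.inr (ι a)) = {l a} := fun a => dif_pos a.2.2
  have h1 := h.data (Finset.univ.disjSum (Finset.univ.map ι)) Set.univ A MeasurableSet.univ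
    (fun _ => MeasurableSet.of_discrete)
  have hset : {s | (∀ j, m j s = n j) ∧ ∀ a : DataPoint n, z a.1 a.2 s = l a} =
      {s | ((fun k => atom k s), (fun j k => θ j k s)) ∈ Set.univ ∧
        ∀ i ∈ Finset.univ.disjSum (Finset.univ.map ι),
          Sum.elim m (fun ji : Fin J × ℕ => z ji.1 ji.2) i s ∈ A i} := by
    ext s
    constructor
    · rintro ⟨hm, hz⟩
      refine ⟨Set.mem_univ _, fun i hi => ?_⟩
      rcases i with j | ji
      · exact hm j
      · obtain ⟨a, -, rfl⟩ := Finset.mem_map.1 (Finset.inr_mem_disjSum.1 hi)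
        rw [hAr]
        exact hz a
    · rintro ⟨-, hs⟩
      refine ⟨fun j => hs (Sum.inl j) (Finset.inl_mem_disjSum.2 (Finset.mem_univ j)), fun a => ?_⟩
      have := hs (Sum.inr (ι a)) (Finset.inr_mem_disjSum.2
        (Finset.mem_map.2 ⟨a, Finset.mem_univ a, rfl⟩))
      rw [hAr] at this
      exact this
  rw [hset, h1, Set.preimage_univ, Measure.restrict_univ, ← lintegral_const_mul']
  · refine lintegral_congr_ae ?_
    filter_upwards [h.ae_weight_nonneg, h.ae_summable hc hr] with s hs1 hs2
    rw [Finset.prod_disjSum, Finset.prod_map]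
    simp only [hAr, Sum.elim_inl, Sum.elim_inr]
    change (∏ j, poissonMeasure (∑' k, θ j k s).toNNReal {n j}) *
      ∏ a : DataPoint n, categorical (fun k => θ a.1 k s) {l a} = _
    rw [Fintype.prod_sigma, ← Finset.prod_mul_distrib,
      Finset.prod_congr rfl fun j _ => poisson_mul_categorical (hs1 j) (hs2 j) (n j)
        fun i => l ⟨j, i⟩, Finset.prod_mul_distrib, Finset.prod_mul_distrib, Fintype.prod_sigma]
    congr 1
    rw [mul_comm]
  · exact ENNReal.prod_ne_top fun j _ => ENNReal.ofReal_ne_top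

end Model

section Weights

variable {S Ω : Type*} [MeasurableSpace S] [MeasurableSpace Ω] {J : ℕ} {P : Measure S}
  {r : Fin J → ℝ} {c : ℝ} {B₀ : Measure Ω}
  {atom : ℕ → S → ℝ × Ω} {θ : Fin J → ℕ → S → ℝ} {m : Fin J → S → ℕ} {z : Fin J → ℕ → S → ℕ}

/-! ### The events of the group sizes and the partition -/

lemma measurableSet_clusters_eq (hz : ∀ j i, Measurable (z j i)) {n : Fin J → ℕ}
    (π : Finpartition (Finset.univ : Finset (DataPoint n))) :
    MeasurableSet {s | clusters n (fun a => z a.1 a.2 s) = π} := by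
  have h1 : Measurable fun s => fun a : DataPoint n => z a.1 a.2 s :=
    measurable_pi_iff.2 fun a => hz _ _
  exact h1 (MeasurableSet.of_discrete (s := {l | clusters n l = π}))

lemma measurableSet_sizes_eq (hm : ∀ j, Measurable (m j)) (n : Fin J → ℕ) :
    MeasurableSet {s | ∀ j, m j s = n j} := by
  have : {s | ∀ j, m j s = n j} = ⋂ j, m j ⁻¹' {n j} := by ext s; simp
  rw [this]
  exact MeasurableSet.iInter fun j => hm j (measurableSet_singleton _)

/-- By `labelEquiv`, a labelling inducing `π` comes from exactly one injection of the blocks into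
the labels. -/
lemma IsModel.measure_clusters_eq_tsum (h : IsModel P r c B₀ atom θ m z) {n : Fin J → ℕ}
    (π : Finpartition (Finset.univ : Finset (DataPoint n))) :
    P {s | (∀ j, m j s = n j) ∧ clusters n (fun a => z a.1 a.2 s) = π} =
      ∑' e : π.parts ↪ ℕ,
        P {s | (∀ j, m j s = n j) ∧ ∀ a : DataPoint n, z a.1 a.2 s = labelOf π e a} := by
  have : Countable (π.parts ↪ ℕ) := Function.Embedding.coe_injective.countable
  have hset : {s | (∀ j, m j s = n j) ∧ clusters n (fun a => z a.1 a.2 s) = π} =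
      ⋃ e : π.parts ↪ ℕ,
        {s | (∀ j, m j s = n j) ∧ ∀ a : DataPoint n, z a.1 a.2 s = labelOf π e a} := by
    ext s
    simp only [Set.mem_iUnion, Set.mem_ofPred_eq, clusters_eq_iff]
    constructor
    · rintro ⟨hm, hl⟩
      obtain ⟨e, he⟩ := (labelEquiv π ℕ).surjective ⟨_, hl⟩
      exact ⟨e, hm, fun a => (congrFun (congrArg Subtype.val he) a).symm⟩
    · rintro ⟨e, hm, hl⟩
      refine ⟨hm, ?_⟩
      simp_rw [hl]
      exact (labelEquiv π ℕ e).2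
  rw [hset, measure_iUnion]
  · intro e e' hne
    refine Set.disjoint_left.2 fun s hs hs' => hne ?_
    refine (labelEquiv π ℕ).injective (Subtype.ext (funext fun a => ?_))
    exact (hs.2 a).symm.trans (hs'.2 a)
  · intro e
    have h1 : {s | (∀ j, m j s = n j) ∧ ∀ a : DataPoint n, z a.1 a.2 s = labelOf π e a} =
        {s | ∀ j, m j s = n j} ∩ ⋂ a : DataPoint n, z a.1 a.2 ⁻¹' {labelOf π e a} := by
      ext s; simp
    rw [h1]
    exact (measurableSet_sizes_eq h.measurable_size n).inter
      (MeasurableSet.iInter fun a => h.measurable_label _ _ (measurableSet_singleton _))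

variable [IsProbabilityMeasure P] [IsFiniteMeasure B₀]

/-! ### Integrating out the weights -/

/-- A bound uniform in `t`, used for dominated convergence when the weights are integrated out. -/
lemma pow_mul_exp_neg_le {t : ℝ} (ht : 0 ≤ t) (k : ℕ) :
    t ^ k * Real.exp (-t) ≤ k.factorial := by
  have h1 := Real.pow_div_factorial_le_exp t ht k
  rw [div_le_iff₀ (by positivity)] at h1
  rw [Real.exp_neg, ← div_eq_mul_inv, div_le_iff₀ (Real.exp_pos t)]
  linarith

/-- Conditional independence only handles finitely many weights. The labels are therefore cut off at
`M + N₀`, beyond every label in use, the gamma integrals are computed there, and `M` tends to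
infinity on both sides by dominated convergence. -/
lemma IsModel.lintegral_weights (h : IsModel P r c B₀ atom θ m z) (hc : 0 < c) (hr : ∀ j, 0 < r j)
    {n : Fin J → ℕ} (π : Finpartition (Finset.univ : Finset (DataPoint n))) (e : π.parts ↪ ℕ) :
    ∫⁻ s, (∏ A, ∏ j, ENNReal.ofReal (θ j (e A) s) ^ clusterSize A.1 j) *
        ∏ j, ENNReal.ofReal (Real.exp (-∑' k, θ j k s)) ∂P =
      ∫⁻ s, (∏ A, ∏ j, ENNReal.ofReal (Real.Gamma (clusterSize A.1 j + r j) / Real.Gamma (r j)) *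
          ENNReal.ofReal (atom (e A) s).1 ^ clusterSize A.1 j) *
        ∏' k, ENNReal.ofReal ((1 - (atom k s).1) ^ ∑ j, r j) ∂P := by
  classical
  obtain ⟨N₀, hN₀⟩ : ∃ N₀, ∀ A, e A < N₀ := by
    obtain ⟨N, hN⟩ := (Set.finite_range e).bddAbove
    exact ⟨N + 1, fun A => Nat.lt_succ_of_le (hN ⟨A, rfl⟩)⟩
  have hlt : ∀ M A, e A < M + N₀ := fun M A => (hN₀ A).trans_le (Nat.le_add_left _ _)
  -- Unused labels have count vector 0, so their weights enter only through `exp (-t)`.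
  let v : ℕ → Fin J → ℕ := fiberSizes (labelOf π e)
  have hprod : ∀ (H : ℕ → (Fin J → ℕ) → ℝ≥0∞), (∀ k, H k 0 = 1) → ∀ M,
      ∏ k ∈ Finset.range (M + N₀), H k (v k) = ∏ A, H (e A) (clusterSize A.1) :=
    fun H hH M => prod_range_fiberSizes π e H hH (hlt M)
  let u : Fin J × ℕ → ℝ → ℝ≥0∞ := fun jk t => ENNReal.ofReal (t ^ v jk.2 jk.1 * Real.exp (-t))
  have hu : ∀ jk, Measurable (u jk) := fun jk => by fun_prop
  have hG0 : ∀ j, Real.Gamma (r j) / Real.Gamma (r j) = 1 := fun j =>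
    div_self (Real.Gamma_pos_of_pos (hr j)).ne'
  have hΓ : ∀ j (q : ℕ), 0 ≤ Real.Gamma (q + r j) / Real.Gamma (r j) := fun j q =>
    div_nonneg (Real.Gamma_nonneg_of_nonneg (add_nonneg q.cast_nonneg (hr j).le))
      (Real.Gamma_pos_of_pos (hr j)).le
  have key : ∀ M, ∫⁻ s, ∏ k ∈ Finset.range (M + N₀), ∏ j, u (j, k) (θ j k s) ∂P =
      ∫⁻ s, (∏ A, ∏ j, ENNReal.ofReal (Real.Gamma (clusterSize A.1 j + r j) / Real.Gamma (r j)) *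
          ENNReal.ofReal (atom (e A) s).1 ^ clusterSize A.1 j) *
        ∏ k ∈ Finset.range (M + N₀), ENNReal.ofReal ((1 - (atom k s).1) ^ ∑ j, r j) ∂P := by
    intro M
    have h1 := h.gamma_process.lintegral_prod h.measurable_atoms
      (fun jk => h.measurable_weight jk.1 jk.2) (measurable_gamma_kernel r)
      (Finset.univ ×ˢ Finset.range (M + N₀)) MeasurableSet.univ hu
    simp only [Set.preimage_univ, Measure.restrict_univ, Finset.prod_product_right] at h1
    rw [h1]
    refine lintegral_congr_ae ?_
    filter_upwards [h.ae_mem_Ioo] with s hs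
    have h2 : ∀ k j, ∫⁻ t, u (j, k) t ∂gammaMeasure (r j) ((1 - (atom k s).1) / (atom k s).1) =
        ENNReal.ofReal (Real.Gamma (v k j + r j) / Real.Gamma (r j)) *
          ENNReal.ofReal (atom k s).1 ^ v k j * ENNReal.ofReal ((1 - (atom k s).1) ^ r j) := by
      intro k j
      have hp0 := (hs k).1
      have hp1 : 0 < 1 - (atom k s).1 := sub_pos.2 (hs k).2
      rw [← ENNReal.ofReal_pow hp0.le, ← ENNReal.ofReal_mul (hΓ _ _),
        ← ENNReal.ofReal_mul (mul_nonneg (hΓ _ _) (by positivity))]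
      refine (lintegral_gammaMeasure_pow_mul_exp_neg (hr j) (hs k) _).trans ?_
      congr 1
      ring
    simp_rw [h2, Finset.prod_mul_distrib (g := fun j => ENNReal.ofReal (_ ^ r j))]
    rw [Finset.prod_mul_distrib]
    congr 1
    · refine hprod (fun k w => ∏ j, ENNReal.ofReal (Real.Gamma (w j + r j) / Real.Gamma (r j)) *
          ENNReal.ofReal (atom k s).1 ^ w j) (fun k => ?_) M
      simp [hG0]
    · refine Finset.prod_congr rfl fun k _ => ?_
      have hp1 : 0 < 1 - (atom k s).1 := sub_pos.2 (hs k).2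
      rw [← ENNReal.ofReal_prod_of_nonneg fun j _ => by positivity, Real.rpow_sum_of_pos hp1]
  have hL : Tendsto (fun M => ∫⁻ s, ∏ k ∈ Finset.range (M + N₀), ∏ j, u (j, k) (θ j k s) ∂P) atTop
      (𝓝 (∫⁻ s, (∏ A, ∏ j, ENNReal.ofReal (θ j (e A) s) ^ clusterSize A.1 j) *
        ∏ j, ENNReal.ofReal (Real.exp (-∑' k, θ j k s)) ∂P)) := by
    refine tendsto_lintegral_of_dominated_convergence
      (fun _ => ∏ A : π.parts, ∏ j, ((clusterSize A.1 j).factorial : ℝ≥0∞)) (fun M => ?_) (fun M => ?_)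
      ?_ ?_
    · exact Finset.measurable_fun_prod _ fun k _ => Finset.measurable_fun_prod _ fun j _ =>
        (hu (j, k)).comp (h.measurable_weight j k)
    · filter_upwards [h.ae_weight_nonneg] with s hs
      rw [← hprod (fun _ w => ∏ j, ((w j).factorial : ℝ≥0∞)) (fun k => by simp) M]
      refine Finset.prod_le_prod' fun k _ => Finset.prod_le_prod' fun j _ => ?_
      rw [← ENNReal.ofReal_natCast]
      exact ENNReal.ofReal_le_ofReal (pow_mul_exp_neg_le (hs j k) _)
    · rw [lintegral_const, measure_univ, mul_one]
      exact ENNReal.prod_ne_top fun A _ => ENNReal.prod_ne_top fun j _ => ENNReal.natCast_ne_top _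
    · filter_upwards [h.ae_weight_nonneg, h.ae_summable hc hr] with s hs1 hs2
      have h1 : ∀ M, ∏ k ∈ Finset.range (M + N₀), ∏ j, u (j, k) (θ j k s) =
          (∏ A, ∏ j, ENNReal.ofReal (θ j (e A) s) ^ clusterSize A.1 j) *
            ∏ j, ENNReal.ofReal (Real.exp (-∑ k ∈ Finset.range (M + N₀), θ j k s)) := by
        intro M
        rw [← hprod (fun k w => ∏ j, ENNReal.ofReal (θ j k s) ^ w j) (fun k => by simp) M]
        simp_rw [← Finset.sum_neg_distrib, Real.exp_sum]
        rw [Finset.prod_congr rfl fun j _ => ENNReal.ofReal_prod_of_nonneg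
          fun k _ => (Real.exp_pos (-θ j k s)).le, Finset.prod_comm (s := Finset.univ),
          ← Finset.prod_mul_distrib]
        refine Finset.prod_congr rfl fun k _ => ?_
        rw [← Finset.prod_mul_distrib]
        refine Finset.prod_congr rfl fun j _ => ?_
        rw [← ENNReal.ofReal_pow (hs1 j k), ← ENNReal.ofReal_mul (pow_nonneg (hs1 j k) _)]
      simp_rw [h1]
      refine ENNReal.Tendsto.const_mul ?_ (Or.inr ?_)
      · refine ENNReal.tendsto_finsetProd_of_ne_top _ (fun j _ => ?_)
          fun j _ => ENNReal.ofReal_ne_top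
        refine ENNReal.tendsto_ofReal ((Real.continuous_exp.tendsto _).comp (Tendsto.neg ?_))
        exact (hs2 j).hasSum.tendsto_sum_nat.comp (tendsto_add_atTop_nat N₀)
      · exact ENNReal.prod_ne_top fun A _ => ENNReal.prod_ne_top fun j _ =>
          ENNReal.pow_ne_top ENNReal.ofReal_ne_top
  have hR : Tendsto (fun M =>
      ∫⁻ s, (∏ A, ∏ j, ENNReal.ofReal (Real.Gamma (clusterSize A.1 j + r j) / Real.Gamma (r j)) *
          ENNReal.ofReal (atom (e A) s).1 ^ clusterSize A.1 j) *
        ∏ k ∈ Finset.range (M + N₀), ENNReal.ofReal ((1 - (atom k s).1) ^ ∑ j, r j) ∂P) atTop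
      (𝓝 (∫⁻ s, (∏ A, ∏ j,
          ENNReal.ofReal (Real.Gamma (clusterSize A.1 j + r j) / Real.Gamma (r j)) *
            ENNReal.ofReal (atom (e A) s).1 ^ clusterSize A.1 j) *
        ∏' k, ENNReal.ofReal ((1 - (atom k s).1) ^ ∑ j, r j) ∂P)) := by
    have hle : ∀ s, (∀ k, (atom k s).1 ∈ Set.Ioo (0 : ℝ) 1) → ∀ k,
        ENNReal.ofReal ((1 - (atom k s).1) ^ ∑ j, r j) ≤ 1 := fun s hs k => by
      rw [ENNReal.ofReal_le_one]
      exact Real.rpow_le_one (sub_nonneg.2 (hs k).2.le) (by linarith [(hs k).1])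
        (Finset.sum_nonneg fun j _ => (hr j).le)
    have hpm : ∀ k, Measurable fun s => (atom k s).1 := fun k => (h.beta_process.measurable k).fst
    refine tendsto_lintegral_of_dominated_convergence
      (fun _ => ∏ A : π.parts, ∏ j,
        ENNReal.ofReal (Real.Gamma (clusterSize A.1 j + r j) / Real.Gamma (r j))) (fun M => ?_)
      (fun M => ?_) ?_ ?_
    · refine Measurable.mul (Finset.measurable_fun_prod _ fun A _ =>
        Finset.measurable_fun_prod _ fun j _ =>
          ((hpm _).ennreal_ofReal.pow_const _).const_mul _)
        (Finset.measurable_fun_prod _ fun k _ => ?_)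
      exact (((hpm k).const_sub 1).pow_const _).ennreal_ofReal
    · filter_upwards [h.ae_mem_Ioo] with s hs
      refine (mul_le_of_le_one_right' (Finset.prod_le_one' fun k _ => hle s hs k)).trans ?_
      refine Finset.prod_le_prod' fun A _ => Finset.prod_le_prod' fun j _ => ?_
      refine mul_le_of_le_one_right' (pow_le_one' ?_ _)
      rw [ENNReal.ofReal_le_one]
      exact (hs _).2.le
    · rw [lintegral_const, measure_univ, mul_one]
      exact ENNReal.prod_ne_top fun A _ => ENNReal.prod_ne_top fun j _ => ENNReal.ofReal_ne_top
    · filter_upwards [h.ae_mem_Ioo] with s hs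
      refine ENNReal.Tendsto.const_mul ?_ (Or.inr ?_)
      · exact (ENNReal.multipliable_of_le_one (hle s hs)).hasProd.tendsto_prod_nat.comp
          (tendsto_add_atTop_nat N₀)
      · exact ENNReal.prod_ne_top fun A _ => ENNReal.prod_ne_top fun j _ =>
          ENNReal.mul_ne_top ENNReal.ofReal_ne_top (ENNReal.pow_ne_top ENNReal.ofReal_ne_top)
  exact tendsto_nhds_unique hL (by simpa only [key] using hR)

/-! ### The joint law of the group sizes and the partition -/

lemma ae_betaLevy_mem_Ioo : ∀ᵐ y ∂betaLevy c B₀, y.1 ∈ Set.Ioo (0 : ℝ) 1 := by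
  rw [ae_iff, ← betaLevy_compl_Ioo (c := c) (B₀ := B₀)]
  congr 1
  ext y
  simp

lemma one_sub_one_sub_rpow {p q : ℝ} (hp : p ∈ Set.Ioo (0 : ℝ) 1) (hq : 0 ≤ q) :
    (1 : ℝ≥0∞) - (1 - ENNReal.ofReal ((1 - p) ^ q)) = ENNReal.ofReal ((1 - p) ^ q) := by
  refine ENNReal.sub_sub_cancel ENNReal.one_ne_top ?_
  rw [ENNReal.ofReal_le_one]
  exact Real.rpow_le_one (sub_nonneg.2 hp.2.le) (by linarith [hp.1]) hq

theorem IsModel.measure_clusters (h : IsModel P r c B₀ atom θ m z) (hc : 0 < c)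
    (hr : ∀ j, 0 < r j) (n : Fin J → ℕ)
    (π : Finpartition (Finset.univ : Finset (DataPoint n))) :
    P {s | (∀ j, m j s = n j) ∧ clusters n (fun a => z a.1 a.2 s) = π} =
      ENNReal.ofReal (Real.exp (-(B₀.real Set.univ * (digamma (c + ∑ j, r j) - digamma c))) *
        eppfNumerator r c (B₀.real Set.univ) n π) := by
  have : Countable (π.parts ↪ ℕ) := Function.Embedding.coe_injective.countable
  set ρ := ∑ j, r j with hρ
  have hρ0 : 0 ≤ ρ := Finset.sum_nonneg fun j _ => (hr j).le
  let G : π.parts → ℝ := fun A =>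
    ∏ j, Real.Gamma (clusterSize A.1 j + r j) / Real.Gamma (r j)
  have hΓ : ∀ j (q : ℕ), 0 ≤ Real.Gamma (q + r j) / Real.Gamma (r j) := fun j q =>
    div_nonneg (Real.Gamma_nonneg_of_nonneg (add_nonneg q.cast_nonneg (hr j).le))
      (Real.Gamma_pos_of_pos (hr j)).le
  have hG : ∀ A, 0 ≤ G A := fun A => Finset.prod_nonneg fun j _ => hΓ j _
  let N : π.parts → ℕ := fun A => ∑ j, clusterSize A.1 j
  have hN : ∀ A, 1 ≤ N A := fun A => one_le_sum_clusterSize A.2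
  let f : π.parts → ℝ × Ω → ℝ≥0∞ := fun A y => ENNReal.ofReal (y.1 ^ N A)
  -- Chosen so that `1 - φ` is the factor `(1 - p) ^ ρ` that every atom contributes, used or not.
  let φ : ℝ × Ω → ℝ≥0∞ := fun y => 1 - ENNReal.ofReal ((1 - y.1) ^ ρ)
  have hf : ∀ A, Measurable (f A) := fun A => by fun_prop
  have hφ : Measurable φ := by fun_prop
  have hfi : ∀ A, ∫⁻ y, f A y ∂betaLevy c B₀ ≠ ⊤ := fun A => by
    have h1 := lintegral_betaLevy_pow_mul_rpow (B₀ := B₀) hc le_rfl (hN A)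
    simp only [Real.rpow_zero, ENNReal.ofReal_one, mul_one] at h1
    rw [h1]
    exact ENNReal.mul_ne_top (measure_ne_top _ _) ENNReal.ofReal_ne_top
  have hφint : ∫⁻ y, φ y ∂betaLevy c B₀ =
      B₀ Set.univ * ENNReal.ofReal (digamma (c + ρ) - digamma c) :=
    lintegral_betaLevy_one_sub_rpow hc hρ0
  have hfφ : ∀ A, ∫⁻ y, f A y * (1 - φ y) ∂betaLevy c B₀ =
      B₀ Set.univ * ENNReal.ofReal (beta (N A) (c + ρ)) := fun A => by
    rw [← lintegral_betaLevy_pow_mul_rpow hc hρ0 (hN A)]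
    refine lintegral_congr_ae ?_
    filter_upwards [ae_betaLevy_mem_Ioo] with y hy
    rw [one_sub_one_sub_rpow hy hρ0]
  have campbell := h.beta_process.lintegral_tsum_embedding f φ hf
    (fun _ _ => ENNReal.ofReal_ne_top) hfi hφ (fun _ => tsub_le_self)
    (by rw [hφint]; exact ENNReal.mul_ne_top (measure_ne_top _ _) ENNReal.ofReal_ne_top)
  simp_rw [hfφ] at campbell
  rw [hφint] at campbell
  rw [h.measure_clusters_eq_tsum π]
  have hterm : ∀ e : π.parts ↪ ℕ,
      P {s | (∀ j, m j s = n j) ∧ ∀ a : DataPoint n, z a.1 a.2 s = labelOf π e a} =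
      (∏ j, ENNReal.ofReal (1 / (n j).factorial)) * ((∏ A, ENNReal.ofReal (G A)) *
        ∫⁻ s, (∏ A, f A (atom (e A) s)) * ∏' k, (1 - φ (atom k s)) ∂P) := by
    intro e
    rw [h.measure_labels hc hr n]
    simp_rw [fun s => prod_labelOf π e fun j k => ENNReal.ofReal (θ j k s)]
    rw [h.lintegral_weights hc hr π e]
    congr 1
    rw [← lintegral_const_mul' _ _ (ENNReal.prod_ne_top fun A _ => ENNReal.ofReal_ne_top)]
    refine lintegral_congr_ae ?_
    filter_upwards [h.ae_mem_Ioo] with s hs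
    rw [← mul_assoc, ← Finset.prod_mul_distrib]
    congr 1
    · refine Finset.prod_congr rfl fun A _ => ?_
      rw [Finset.prod_mul_distrib, Finset.prod_pow_eq_pow_sum,
        ← ENNReal.ofReal_prod_of_nonneg fun j _ => hΓ j _, ← ENNReal.ofReal_pow (hs _).1.le]
    · exact tprod_congr fun k => (one_sub_one_sub_rpow (hs k) hρ0).symm
  simp_rw [hterm]
  have hgm : Measurable fun s => ∏' k, (1 - φ (atom k s)) :=
    measurable_tprod (fun k => (hφ.comp (h.beta_process.measurable k)).const_sub 1)
      fun k s => tsub_le_self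
  have hem : ∀ e : π.parts ↪ ℕ, Measurable fun s =>
      (∏ A, f A (atom (e A) s)) * ∏' k, (1 - φ (atom k s)) := fun e =>
    (Finset.measurable_fun_prod _ fun A _ =>
      (hf A).comp (h.beta_process.measurable (e A))).mul hgm
  -- Moving the sum over injections inside the expectation produces the left side of the
  -- Campbell–Mecke formula.
  rw [ENNReal.tsum_mul_left, ENNReal.tsum_mul_left,
    ← lintegral_tsum fun e => (hem e).aemeasurable]
  simp_rw [ENNReal.tsum_mul_right]
  rw [campbell]
  have hd := (lintegral_one_sub_rpow_eq_digamma_sub hc hρ0).1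
  have hγ : B₀ Set.univ = ENNReal.ofReal (B₀.real Set.univ) :=
    (ofReal_measureReal (measure_ne_top _ _)).symm
  have hγ0 : 0 ≤ B₀.real Set.univ := measureReal_nonneg
  have hβ : ∀ A, 0 ≤ beta (N A) (c + ρ) := fun A =>
    (beta_pos (by exact_mod_cast hN A) (by linarith)).le
  simp_rw [hγ, ← ENNReal.ofReal_mul hγ0]
  rw [ENNReal.toReal_ofReal (mul_nonneg hγ0 hd),
    ← ENNReal.ofReal_prod_of_nonneg fun _ _ => by positivity,
    ← ENNReal.ofReal_prod_of_nonneg fun A _ => hG A,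
    ← ENNReal.ofReal_prod_of_nonneg fun A _ => mul_nonneg hγ0 (hβ A),
    ← ENNReal.ofReal_mul (Finset.prod_nonneg fun A _ => mul_nonneg hγ0 (hβ A)),
    ← ENNReal.ofReal_mul (Finset.prod_nonneg fun A _ => hG A),
    ← ENNReal.ofReal_mul (Finset.prod_nonneg fun j _ => by positivity)]
  congr 1
  have hctw : ∀ A : π.parts, columnTotalWeight r c (clusterSize A.1) = beta (N A) (c + ρ) := by
    intro A
    rw [columnTotalWeight, beta]
    simp only [N, Nat.cast_sum]
    congr 2
    ring
  rw [eppfNumerator, ← Finset.prod_coe_sort π.parts fun A => columnTotalWeight r c (clusterSize A) *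
      ∏ j, Real.Gamma (clusterSize A j + r j) / Real.Gamma (r j)]
  simp_rw [hctw]
  rw [Finset.prod_mul_distrib, Finset.prod_mul_distrib, Finset.prod_const, Finset.card_univ,
    Fintype.card_coe, Finset.prod_div_distrib, Finset.prod_const_one]
  simp only [G]
  ring

end Weights

end BNBP

end

/-! ### Law of the group sizes and conditional law of the partition -/

theorem lemma3 {S Ω : Type*} [MeasurableSpace S] (P : Measure S) [IsProbabilityMeasure P]
    [MetricSpace Ω] [CompleteSpace Ω] [TopologicalSpace.SeparableSpace Ω]
    [MeasurableSpace Ω] [BorelSpace Ω]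
    (B₀ : Measure Ω) [IsFiniteMeasure B₀] [NullSingletonClass B₀] (hB₀ : B₀ ≠ 0)
    (c : ℝ) (hc : 0 < c) {J : ℕ} (r : Fin J → ℝ) (hr : ∀ j, 0 < r j)
    (atom : ℕ → S → ℝ × Ω) (θ : Fin J → ℕ → S → ℝ) (m : Fin J → S → ℕ)
    (z : Fin J → ℕ → S → ℕ) (model : BNBP.IsModel P r c B₀ atom θ m z)
    (n : Fin J → ℕ) (hn : 1 ≤ ∑ j, n j) :
    -- the marginal probability mass function of the group sizes
    0 < P.real {s | ∀ j, m j s = n j} ∧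
    P.real {s | ∀ j, m j s = n j} =
      Real.exp (-(B₀.real Set.univ *
        (BNBP.digamma (c + ∑ j, r j) - BNBP.digamma c))) *
        BNBP.eppfDenominator r c (B₀.real Set.univ) n ∧
    -- the conditional distribution of the partition given the group sizes
    (∀ π : Finpartition (Finset.univ : Finset (BNBP.DataPoint n)),
      (P[|{s | ∀ j, m j s = n j}]).real
          {s | BNBP.clusters n (fun x => z x.1 x.2 s) = π} =
        BNBP.eppfNumerator r c (B₀.real Set.univ) n π /
          BNBP.eppfDenominator r c (B₀.real Set.univ) n) ∧
    -- it depends only on the collection of the cluster sizes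
    (∀ π π' : Finpartition (Finset.univ : Finset (BNBP.DataPoint n)),
      π.parts.val.map BNBP.clusterSize = π'.parts.val.map BNBP.clusterSize →
      (P[|{s | ∀ j, m j s = n j}]).real
          {s | BNBP.clusters n (fun x => z x.1 x.2 s) = π} =
        (P[|{s | ∀ j, m j s = n j}]).real
          {s | BNBP.clusters n (fun x => z x.1 x.2 s) = π'}) := by
  classical
  have hγ : 0 < B₀.real Set.univ :=
    ENNReal.toReal_pos (Measure.measure_univ_ne_zero.2 hB₀) (measure_ne_top _ _)
  set γ := B₀.real Set.univ
  set C := Real.exp (-(γ * (BNBP.digamma (c + ∑ j, r j) - BNBP.digamma c)))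
  have hC : 0 < C := Real.exp_pos _
  have hnum : ∀ π : Finpartition (Finset.univ : Finset (BNBP.DataPoint n)),
      0 < BNBP.eppfNumerator r c γ n π := BNBP.eppfNumerator_pos hc hr hγ
  have hden : 0 < BNBP.eppfDenominator r c γ n := by
    -- As a sum over partitions, the denominator is visibly positive.
    rw [← BNBP.sum_eppfNumerator r c γ hn]
    exact Finset.sum_pos (fun π _ => hnum π) Finset.univ_nonempty
  have hmeas : MeasurableSet {s | ∀ j, m j s = n j} :=
    BNBP.measurableSet_sizes_eq model.measurable_size n
  have hjoint : ∀ π : Finpartition (Finset.univ : Finset (BNBP.DataPoint n)),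
      P.real ({s | ∀ j, m j s = n j} ∩ {s | BNBP.clusters n (fun x => z x.1 x.2 s) = π}) =
        C * BNBP.eppfNumerator r c γ n π := fun π => by
    rw [measureReal_def, ← ENNReal.toReal_ofReal (mul_pos hC (hnum π)).le]
    exact congrArg ENNReal.toReal (model.measure_clusters hc hr n π)
  -- Each outcome with sizes `n` induces exactly one partition, so the marginal is the sum of the
  -- joint probabilities.
  have hmarg : P.real {s | ∀ j, m j s = n j} = C * BNBP.eppfDenominator r c γ n := by
    rw [← BNBP.sum_eppfNumerator r c γ hn, Finset.mul_sum, ← Finset.sum_congr rfl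
      fun π _ => hjoint π, ← measureReal_biUnion_finset]
    · congr 1
      ext s
      simp
    · intro π _ π' _ hne
      exact Set.disjoint_left.2 fun s hs hs' => hne (hs.2.symm.trans hs'.2)
    · exact fun π _ => hmeas.inter (BNBP.measurableSet_clusters_eq model.measurable_label π)
  have hcond : ∀ π : Finpartition (Finset.univ : Finset (BNBP.DataPoint n)),
      (P[|{s | ∀ j, m j s = n j}]).real {s | BNBP.clusters n (fun x => z x.1 x.2 s) = π} =
        BNBP.eppfNumerator r c γ n π / BNBP.eppfDenominator r c γ n := fun π => by
    rw [measureReal_def, cond_apply hmeas, ENNReal.toReal_mul, ENNReal.toReal_inv,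
      ← measureReal_def, ← measureReal_def, hjoint, hmarg]
    field_simp
  refine ⟨hmarg ▸ mul_pos hC hden, hmarg, hcond, fun π π' h => ?_⟩
  rw [hcond, hcond, BNBP.eppfNumerator_congr r c γ h]
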